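/- A domain is a nonempty connected open subset of $\mathbb{C}$, and $dA$ is area measure. For a domain $D$, an admissible weight, $\mu\in AW(D)$, is a positive measurable function $\mu$ on $D$ such that the space $A^2_\mu(D)$ of holomorphic functions $f$ on $D$ with $\int_D|f|^2\mu\,dA<\infty$ is closed in $L^2_\mu(D)$ and the evaluations $A^2_\mu(D)\ni f\mapsto f(z)$, $z\in D$, are continuous. For $n\ge 1$ and $\zeta\in D$ let $AD^\mu(D,\zeta^n)$ be the space of holomorphic $f$ on $D$ with $f(\zeta)=f'(\zeta)=\dots=f^{(n-1)}(\zeta)=0$ and $\int_D|f'|^2\mu\,dA<\infty$, with inner product $\langle f,g\rangle=\int_D f'\,\overline{g'}\,\mu\,dA$. For every domain $D$, $\mu\in AW(D)$, $n\ge1$ and $\zeta\in D$ there is a unique $M_{D,\mu,n}(\cdot,\zeta)\in AD^\mu(D,\zeta^n)$ with $f^{(n)}(\zeta)=\langle f,M_{D,\mu,n}(\cdot,\zeta)\rangle$ for all $f\in AD^\mu(D,\zeta^n)$ (the $n$-th order kernel function). Put $\tilde K_{D,\mu}(z,\zeta)=\frac{\partial}{\partial z}M_{D,\mu,1}(z,\zeta)$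 and $N_D(\mu)=\{z\in D:\tilde K_{D,\mu}(z,z)=0\}$. Let $(D_i)_{i\ge1}$ be a sequence of domains with $\mu_i\in AW(D_i)$. (1) Let $D=\bigcup_i D_i$ and $\mu\in AW(D)$. Suppose that for every $i$ there is a $j(i)$ such that $D_i\subset D_k$ and $\mu_i(z)\le\mu_k(z)\le\mu(z)$ for all $k\ge j(i)$ and $z\in D_i$, and that $\mu_i\to\mu$ pointwise a.e. on $D$. Then for all $n\ge1$ and all $\xi\in D$, $M_{D_i,\mu_i,n}(\cdot,\xi)\to M_{D,\mu,n}(\cdot,\xi)$ locally uniformly on $D$. (2) Suppose that $D=\bigcap_i D_i$ is a domain, $\mu\in AW(D)$, $\mu\le\mu_i$ on $D$ for all $i$, $\mu_i\to\mu$ pointwise a.e. on $D$, and $\tilde K_{D_i,\mu_i}(t,t)\to\tilde K_{D,\mu}(t,t)$ for every $t\in D$. Then (a) for all $\xi\in D$, $M_{D_i,\mu_i,1}(\cdot,\xi)\to M_{D,\mu,1}(\cdot,\xi)$ locally uniformly on $D$; (b) for all $n>1$ and all $\xi\in D\setminus N_D(\mu)$, $M_{D_i,\mu_i,n}(\cdot,\xi)\to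 M_{D,\mu,n}(\cdot,\xi)$ locally uniformly on $D$. -/

import Mathlib

open MeasureTheory Filter Topology

namespace ReducedBergman

/-- A domain in the complex plane: a nonempty connected open set. -/
def IsPlanarDomain (D : Set ℂ) : Prop := IsOpen D ∧ IsConnected D

/-- The measure `μ dA` on `D`, so that `Lp ℂ 2 (weightedArea D μ)` is the space `L²_μ(D)`. -/
noncomputable def weightedArea (D : Set ℂ) (μ : ℂ → ℝ) : Measure ℂ :=
  (volume.restrict D).withDensity (fun z => ENNReal.ofReal (μ z))

/-- The weighted Bergman space `A²_μ(D)`. Only the values of its elements on `D` matter. -/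
def bergmanSpace (D : Set ℂ) (μ : ℂ → ℝ) : Set (ℂ → ℂ) :=
  {f | DifferentiableOn ℂ f D ∧ IntegrableOn (fun z => ‖f z‖ ^ 2 * μ z) D}

/-- Admissible weights on `D`: positive measurable functions `μ` on `D` such that `A²_μ(D)` is
closed in `L²_μ(D)` and all point evaluations on `A²_μ(D)` are continuous (that is, bounded). -/
structure AdmissibleWeight (D : Set ℂ) (μ : ℂ → ℝ) : Prop where
  measurable : AEMeasurable μ (volume.restrict D)
  pos : ∀ z ∈ D, 0 < μ z
  isClosed : IsClosed {g : Lp ℂ 2 (weightedArea D μ) |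
    ∃ f ∈ bergmanSpace D μ, (g : ℂ → ℂ) =ᵐ[weightedArea D μ] f}
  evaluation : ∀ z ∈ D, ∃ C : ℝ, ∀ f ∈ bergmanSpace D μ,
    ‖f z‖ ≤ C * Real.sqrt (∫ x in D, ‖f x‖ ^ 2 * μ x)

/-- The space `AD^μ(D, ζⁿ)`: holomorphic functions on `D` that vanish at `ζ` together with their
derivatives of order less than `n`, and whose derivative is square integrable against `μ`. -/
def adSpace (D : Set ℂ) (μ : ℂ → ℝ) (n : ℕ) (ζ : ℂ) : Set (ℂ → ℂ) :=
  {f | DifferentiableOn ℂ f D ∧ (∀ k < n, iteratedDeriv k f ζ = 0) ∧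
    IntegrableOn (fun z => ‖deriv f z‖ ^ 2 * μ z) D}

/-- The inner product of `AD^μ(D, ζⁿ)`, linear in the first argument. -/
noncomputable def adInner (D : Set ℂ) (μ : ℂ → ℝ) (f g : ℂ → ℂ) : ℂ :=
  ∫ z in D, deriv f z * starRingEnd ℂ (deriv g z) * (μ z : ℂ)

/-- `M` lies in `AD^μ(D, ζⁿ)` and represents the functional `f ↦ f⁽ⁿ⁾(ζ)` there. -/
def IsKernelFunction (D : Set ℂ) (μ : ℂ → ℝ) (n : ℕ) (ζ : ℂ) (M : ℂ → ℂ) : Prop :=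
  M ∈ adSpace D μ n ζ ∧ ∀ f ∈ adSpace D μ n ζ, iteratedDeriv n f ζ = adInner D μ f M

open Classical in
/-- The `n`-th order kernel function `M_{D,μ,n}(·, ζ)`, as a function of its first variable.
It is determined on `D`; its values off `D` are irrelevant. -/
noncomputable def kernelM (D : Set ℂ) (μ : ℂ → ℝ) (n : ℕ) (ζ : ℂ) : ℂ → ℂ :=
  if h : ∃ M, IsKernelFunction D μ n ζ M then h.choose else 0

/-- The `n`-th order weighted reduced Bergman kernel `∂/∂z M_{D,μ,n}(z, ζ)`. -/
noncomputable def reducedKernel (D : Set ℂ) (μ : ℂ → ℝ) (n : ℕ) (z ζ : ℂ) : ℂ :=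
  deriv (kernelM D μ n ζ) z

/-- The set `N_D(μ)` of zeros in `D` of the first order kernel on the diagonal. -/
def kernelZeros (D : Set ℂ) (μ : ℂ → ℝ) : Set ℂ :=
  {z | z ∈ D ∧ reducedKernel D μ 1 z z = 0}

end ReducedBergman

/-! ### Weighted Bergman spaces inside `L²_μ(D)` and bounds for point evaluations -/

namespace ReducedBergman

/-! Everything takes place in the Hilbert space of derivatives. Reproducing `M` by itself gives
`‖M'‖² = M⁽ⁿ⁾(ζ)`. If `D ⊆ G` and `μ ≤ ν` on `D`, restriction from `G` to `D` is a contraction, and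
expanding the square yields `‖N' - M'‖²_D ≤ ‖M'‖²_D - ‖N'‖²_G` for the kernels `M` of `D` and `N` of
`G` (`norm_sq_kernel_sub_kernel_le`). Thus convergence of the norms forces convergence of the
kernels, and locally bounded point evaluations make this convergence locally uniform.

For unions the squared norms are eventually decreasing, with limit `L`. The same inequality makes
the kernels Cauchy on each `Ω i`, with limit `g` say. Fatou's lemma gives `‖g'‖² ≤ L`, while
`g⁽ⁿ⁾(ζ) = L`; Cauchy–Schwarz against the kernel of `D` then identifies `L` with its squared norm.

For intersections the hypothesis is convergence of the norms at order one. To reach higher orders,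
let `Rᵢ` be restriction from `Ω i` to `D`. Its adjoint maps first order kernels to first order
kernels, so `Rᵢ Rᵢ* v → v` on their span, which is dense because a function orthogonal to all of
them has zero derivative. Hence each `v` is a limit of restrictions whose norms on `Ω i` are
asymptotically at most `‖v‖` (`Approximable`). This property survives raising the order of
vanishing, by subtracting a small multiple of a fixed type of function (`approximable_succ`), and
for the kernel of `D` it bounds the norms of the kernels of `Ω i` from below. -/

/-- A linear functional that is bounded by the norm of the image under a linear map into a Hilbert
space is represented by a vector of that space. -/
theorem exists_inner_eq_of_norm_le {A E : Type*} [AddCommGroup A] [Module ℂ A]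
    [NormedAddCommGroup E] [InnerProductSpace ℂ E] [CompleteSpace E]
    (Φ : A →ₗ[ℂ] E) (ℓ : A →ₗ[ℂ] ℂ) (C : ℝ) (h : ∀ a, ‖ℓ a‖ ≤ C * ‖Φ a‖) :
    ∃ k : E, ∀ a, inner ℂ k (Φ a) = ℓ a := by
  have hker : LinearMap.ker Φ ≤ LinearMap.ker ℓ := fun a ha => by
    have := h a
    rw [LinearMap.mem_ker.1 ha, norm_zero, mul_zero] at this
    exact LinearMap.mem_ker.2 (norm_le_zero_iff.1 this)
  let e := Φ.quotKerEquivRange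
  let g : LinearMap.range Φ →ₗ[ℂ] ℂ := ((LinearMap.ker Φ).liftQ ℓ hker) ∘ₗ e.symm.toLinearMap
  have hg : ∀ a, g ⟨Φ a, LinearMap.mem_range_self Φ a⟩ = ℓ a := fun a => by
    have : e.symm ⟨Φ a, LinearMap.mem_range_self Φ a⟩ = (LinearMap.ker Φ).mkQ a := by
      rw [LinearEquiv.symm_apply_eq]
      rfl
    simp only [g, LinearMap.comp_apply, LinearEquiv.coe_coe, this]
    simp
  have hb : ∀ x, ‖g x‖ ≤ C * ‖x‖ := by
    rintro ⟨_, a, rfl⟩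
    rw [hg]
    exact h a
  -- The range of `Φ` need not be closed, so the functional is extended by Hahn–Banach before Riesz
  -- is applied.
  obtain ⟨G, hG, -⟩ := exists_extension_norm_eq (𝕜 := ℂ) (LinearMap.range Φ) (g.mkContinuous C hb)
  refine ⟨(InnerProductSpace.toDual ℂ E).symm G, fun a => ?_⟩
  rw [InnerProductSpace.toDual_symm_apply]
  exact (hG ⟨Φ a, LinearMap.mem_range_self Φ a⟩).trans (hg a)

variable {D : Set ℂ} {μ : ℂ → ℝ}

theorem weightedArea_eq (D : Set ℂ) (μ : ℂ → ℝ) : weightedArea D μ =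
    (volume.restrict D).withDensity (fun z => ((μ z).toNNReal : ENNReal)) := rfl

theorem weightedArea_absolutelyContinuous (D : Set ℂ) (μ : ℂ → ℝ) :
    weightedArea D μ ≪ volume.restrict D := withDensity_absolutelyContinuous _ _

theorem ae_weightedArea_of_forall (hD : IsOpen D) {p : ℂ → Prop} (h : ∀ z ∈ D, p z) :
    ∀ᵐ z ∂weightedArea D μ, p z :=
  (weightedArea_absolutelyContinuous D μ).ae_le (ae_restrict_of_forall_mem hD.measurableSet h)

theorem memLp_weightedArea_iff (hD : IsOpen D) (hμ : AdmissibleWeight D μ) {f : ℂ → ℂ}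
    (hf : AEStronglyMeasurable f (volume.restrict D)) :
    MemLp f 2 (weightedArea D μ) ↔ IntegrableOn (fun z => ‖f z‖ ^ 2 * μ z) D := by
  rw [memLp_two_iff_integrable_sq_norm (hf.mono_ac (weightedArea_absolutelyContinuous D μ)),
    weightedArea_eq, integrable_withDensity_iff_integrable_smul₀ hμ.measurable.real_toNNReal]
  refine integrable_congr (ae_restrict_of_forall_mem hD.measurableSet fun z hz => ?_)
  simp only [NNReal.smul_def, Real.coe_toNNReal _ (hμ.pos z hz).le, smul_eq_mul]
  ring

/-- The class in `L²_μ(D)` of a function, zero if it is not square integrable. -/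
noncomputable def l2class (D : Set ℂ) (μ : ℂ → ℝ) (f : ℂ → ℂ) : Lp ℂ 2 (weightedArea D μ) := by
  classical exact if h : MemLp f 2 (weightedArea D μ) then h.toLp f else 0

theorem l2class_of_memLp {f : ℂ → ℂ} (h : MemLp f 2 (weightedArea D μ)) :
    l2class D μ f = h.toLp f := dif_pos h

theorem l2class_congr {f g : ℂ → ℂ} (h : f =ᵐ[weightedArea D μ] g) :
    l2class D μ f = l2class D μ g := by
  by_cases hf : MemLp f 2 (weightedArea D μ)
  · rw [l2class_of_memLp hf, l2class_of_memLp (hf.ae_eq h)]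
    exact MemLp.toLp_congr _ _ h
  · rw [l2class, l2class, dif_neg hf, dif_neg fun hg => hf (hg.ae_eq h.symm)]

theorem coeFn_l2class {f : ℂ → ℂ} (h : MemLp f 2 (weightedArea D μ)) :
    (l2class D μ f : ℂ → ℂ) =ᵐ[weightedArea D μ] f := by
  rw [l2class_of_memLp h]
  exact h.coeFn_toLp

theorem l2class_add {f g : ℂ → ℂ} (hf : MemLp f 2 (weightedArea D μ))
    (hg : MemLp g 2 (weightedArea D μ)) :
    l2class D μ (f + g) = l2class D μ f + l2class D μ g := by
  rw [l2class_of_memLp hf, l2class_of_memLp hg, l2class_of_memLp (hf.add hg), MemLp.toLp_add]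

theorem l2class_smul {f : ℂ → ℂ} (c : ℂ) (hf : MemLp f 2 (weightedArea D μ)) :
    l2class D μ (c • f) = c • l2class D μ f := by
  rw [l2class_of_memLp hf, l2class_of_memLp (hf.const_smul c), MemLp.toLp_const_smul]

/-- The arguments are exchanged on the left because `inner ℂ` is conjugate linear in its first slot.
-/
theorem inner_l2class (hD : IsOpen D) (hμ : AdmissibleWeight D μ) {f g : ℂ → ℂ}
    (hf : MemLp f 2 (weightedArea D μ)) (hg : MemLp g 2 (weightedArea D μ)) :
    inner ℂ (l2class D μ g) (l2class D μ f) =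
      ∫ z in D, f z * starRingEnd ℂ (g z) * (μ z : ℂ) := by
  rw [L2.inner_def]
  have h1 : (fun a => inner ℂ ((l2class D μ g : ℂ → ℂ) a) ((l2class D μ f : ℂ → ℂ) a))
      =ᵐ[weightedArea D μ] fun a => f a * starRingEnd ℂ (g a) := by
    filter_upwards [coeFn_l2class hf, coeFn_l2class hg] with z h1 h2
    rw [RCLike.inner_apply, h1, h2]
  rw [integral_congr_ae h1, weightedArea_eq,
    integral_withDensity_eq_integral_smul₀ hμ.measurable.real_toNNReal]
  refine setIntegral_congr_fun hD.measurableSet fun z hz => ?_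
  simp only [NNReal.smul_def, Real.coe_toNNReal _ (hμ.pos z hz).le, Complex.real_smul]
  ring

theorem norm_sq_l2class (hD : IsOpen D) (hμ : AdmissibleWeight D μ) {f : ℂ → ℂ}
    (hf : MemLp f 2 (weightedArea D μ)) :
    ‖l2class D μ f‖ ^ 2 = ∫ z in D, ‖f z‖ ^ 2 * μ z := by
  have h := inner_l2class hD hμ hf hf
  rw [inner_self_eq_norm_sq_to_K] at h
  have h2 : (fun z => f z * starRingEnd ℂ (f z) * (μ z : ℂ)) =
      fun z => ((‖f z‖ ^ 2 * μ z : ℝ) : ℂ) := by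
    ext z
    rw [Complex.mul_conj, Complex.normSq_eq_norm_sq]
    push_cast
    ring
  rw [h2, integral_complex_ofReal] at h
  refine Complex.ofReal_injective ?_
  rw [← h]
  simp

theorem aestronglyMeasurable_of_differentiableOn (hD : IsOpen D) {f : ℂ → ℂ}
    (hf : DifferentiableOn ℂ f D) : AEStronglyMeasurable f (volume.restrict D) :=
  hf.continuousOn.aestronglyMeasurable hD.measurableSet

theorem mem_bergmanSpace_iff (hD : IsOpen D) (hμ : AdmissibleWeight D μ) {f : ℂ → ℂ} :
    f ∈ bergmanSpace D μ ↔ DifferentiableOn ℂ f D ∧ MemLp f 2 (weightedArea D μ) :=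
  and_congr_right fun hf =>
    (memLp_weightedArea_iff hD hμ (aestronglyMeasurable_of_differentiableOn hD hf)).symm

theorem mem_adSpace_iff (hD : IsOpen D) (hμ : AdmissibleWeight D μ) {n : ℕ} {ζ : ℂ} {f : ℂ → ℂ} :
    f ∈ adSpace D μ n ζ ↔ DifferentiableOn ℂ f D ∧ (∀ k < n, iteratedDeriv k f ζ = 0) ∧
      MemLp (deriv f) 2 (weightedArea D μ) :=
  and_congr_right fun hf => and_congr_right fun _ => (memLp_weightedArea_iff hD hμ
    (aestronglyMeasurable_of_differentiableOn hD (hf.deriv hD))).symm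

/-- The weighted Bergman space as a linear space of functions. -/
def bergmanSubmodule (D : Set ℂ) (μ : ℂ → ℝ) : Submodule ℂ (ℂ → ℂ) where
  carrier := {f | DifferentiableOn ℂ f D ∧ MemLp f 2 (weightedArea D μ)}
  add_mem' hf hg := ⟨hf.1.add hg.1, hf.2.add hg.2⟩
  zero_mem' := ⟨differentiableOn_const 0, MemLp.zero⟩
  smul_mem' c _ hf := ⟨hf.1.const_smul c, hf.2.const_smul c⟩

/-- The map from the weighted Bergman space to `L²_μ(D)`. -/
noncomputable def bergmanToLp (D : Set ℂ) (μ : ℂ → ℝ) :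
    bergmanSubmodule D μ →ₗ[ℂ] Lp ℂ 2 (weightedArea D μ) where
  toFun f := l2class D μ f
  map_add' f g := l2class_add f.2.2 g.2.2
  map_smul' c f := l2class_smul c f.2.2

/-- Evaluation is bounded by the norm of the class, so it factors through the class and has a Riesz
vector, which need not itself be a Bergman function. -/
theorem exists_inner_eq_apply (hD : IsOpen D) (hμ : AdmissibleWeight D μ)
    {z : ℂ} (hz : z ∈ D) : ∃ k : Lp ℂ 2 (weightedArea D μ),
      ∀ f ∈ bergmanSubmodule D μ, inner ℂ k (l2class D μ f) = f z := by
  obtain ⟨C, hC⟩ := hμ.evaluation z hz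
  obtain ⟨k, hk⟩ := exists_inner_eq_of_norm_le (bergmanToLp D μ)
    ((LinearMap.proj z : (ℂ → ℂ) →ₗ[ℂ] ℂ) ∘ₗ (bergmanSubmodule D μ).subtype) C (fun f => by
      have h := hC f ((mem_bergmanSpace_iff hD hμ).2 f.2)
      rwa [← norm_sq_l2class hD hμ f.2.2, Real.sqrt_sq (norm_nonneg _)] at h)
  exact ⟨k, fun f hf => hk ⟨f, hf⟩⟩

/-- The weighted Bergman space as a closed subspace of `L²_μ(D)`. -/
noncomputable def bergmanLp (D : Set ℂ) (μ : ℂ → ℝ) :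
    Submodule ℂ (Lp ℂ 2 (weightedArea D μ)) := LinearMap.range (bergmanToLp D μ)

theorem isClosed_bergmanLp (hD : IsOpen D) (hμ : AdmissibleWeight D μ) :
    IsClosed (bergmanLp D μ : Set (Lp ℂ 2 (weightedArea D μ))) := by
  convert hμ.isClosed using 1
  ext g
  constructor
  · rintro ⟨f, rfl⟩
    exact ⟨f, (mem_bergmanSpace_iff hD hμ).2 f.2, coeFn_l2class f.2.2⟩
  · rintro ⟨f, hf, h⟩
    have hf' := (mem_bergmanSpace_iff hD hμ).1 hf
    exact ⟨⟨f, hf'⟩, Lp.ext ((coeFn_l2class hf'.2).trans h.symm)⟩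

/-- Point evaluations on the weighted Bergman space are bounded uniformly on compact sets. -/
theorem exists_norm_apply_le_of_isCompact (hD : IsOpen D) (hμ : AdmissibleWeight D μ)
    {K : Set ℂ} (hK : IsCompact K) (hKD : K ⊆ D) : ∃ C : ℝ, 0 ≤ C ∧
      ∀ f ∈ bergmanSubmodule D μ, ∀ z ∈ K, ‖f z‖ ≤ C * ‖l2class D μ f‖ := by
  choose! k hk using fun z (hz : z ∈ D) => exists_inner_eq_apply hD hμ hz
  have : CompleteSpace (bergmanLp D μ) := (isClosed_bergmanLp hD hμ).completeSpace_coe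
  -- The evaluations at the points of `K` are pointwise bounded since each `f` is continuous on `K`;
  -- completeness of the Bergman space makes the bound uniform.
  obtain ⟨C, hC⟩ := banach_steinhaus (ι := K)
    (g := fun z => (innerSL ℂ (k z)).comp (bergmanLp D μ).subtypeL) (by
      rintro ⟨_, f, rfl⟩
      obtain ⟨C, hC⟩ := hK.exists_bound_of_continuousOn (f.2.1.continuousOn.mono hKD)
      refine ⟨C, fun z => ?_⟩
      have := hC z z.2
      rwa [← hk z (hKD z.2) f f.2] at this)
  refine ⟨max C 0, le_max_right _ _, fun f hf z hz => ?_⟩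
  have h1 := ((innerSL ℂ (k z)).comp (bergmanLp D μ).subtypeL).le_of_opNorm_le
    ((hC ⟨z, hz⟩).trans (le_max_left C 0)) ⟨l2class D μ f, ⟨f, hf⟩, rfl⟩
  rw [← hk z (hKD hz) f hf]
  exact h1

end ReducedBergman

/-! ### The spaces `AD^μ(D, ζⁿ)` and their kernel functions -/

namespace ReducedBergman

variable {D : Set ℂ} {μ : ℂ → ℝ} {n : ℕ} {ζ : ℂ}

/-- The class in `L²_μ(D)` of the derivative of a function. -/
noncomputable def derivClass (D : Set ℂ) (μ : ℂ → ℝ) (F : ℂ → ℂ) : Lp ℂ 2 (weightedArea D μ) :=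
  l2class D μ (deriv F)

/-- The space `AD^μ(D, ζⁿ)` as a linear space of functions. -/
def adSubmodule (hD : IsOpen D) (hζ : ζ ∈ D) (μ : ℂ → ℝ) (n : ℕ) : Submodule ℂ (ℂ → ℂ) where
  carrier := {F | DifferentiableOn ℂ F D ∧ (∀ k < n, iteratedDeriv k F ζ = 0) ∧
    MemLp (deriv F) 2 (weightedArea D μ)}
  add_mem' {F G} hF hG := by
    refine ⟨hF.1.add hG.1, fun k hk => ?_, (hF.2.2.add hG.2.2).ae_eq
      (ae_weightedArea_of_forall hD fun z hz => ?_)⟩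
    · rw [iteratedDeriv_add ((hF.1.analyticAt (hD.mem_nhds hζ)).contDiffAt)
        ((hG.1.analyticAt (hD.mem_nhds hζ)).contDiffAt), hF.2.1 k hk, hG.2.1 k hk, add_zero]
    · exact (deriv_add (hF.1.differentiableAt (hD.mem_nhds hz))
        (hG.1.differentiableAt (hD.mem_nhds hz))).symm
  zero_mem' := by
    refine ⟨differentiableOn_const 0, fun k _ => iteratedDeriv_const_zero, ?_⟩
    have : deriv (0 : ℂ → ℂ) = 0 := by ext z; exact deriv_const z 0
    rw [this]
    exact MemLp.zero
  smul_mem' c F hF := by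
    refine ⟨hF.1.const_smul c, fun k hk => ?_, (hF.2.2.const_smul c).ae_eq
      (ae_weightedArea_of_forall hD fun z hz => ?_)⟩
    · rw [iteratedDeriv_const_smul ((hF.1.analyticAt (hD.mem_nhds hζ)).contDiffAt) c, hF.2.1 k hk,
        smul_zero]
    · exact (deriv_const_smul c (hF.1.differentiableAt (hD.mem_nhds hz))).symm

theorem mem_adSubmodule_iff (hD : IsOpen D) (hζ : ζ ∈ D) (hμ : AdmissibleWeight D μ) {F : ℂ → ℂ} :
    F ∈ adSubmodule hD hζ μ n ↔ F ∈ adSpace D μ n ζ := (mem_adSpace_iff hD hμ).symm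

theorem derivClass_add (hD : IsOpen D) (hζ : ζ ∈ D) {F G : ℂ → ℂ}
    (hF : F ∈ adSubmodule hD hζ μ n) (hG : G ∈ adSubmodule hD hζ μ n) :
    derivClass D μ (F + G) = derivClass D μ F + derivClass D μ G := by
  rw [derivClass, derivClass, derivClass, ← l2class_add hF.2.2 hG.2.2]
  exact l2class_congr (ae_weightedArea_of_forall hD fun z hz =>
    deriv_add (hF.1.differentiableAt (hD.mem_nhds hz)) (hG.1.differentiableAt (hD.mem_nhds hz)))

theorem derivClass_smul (hD : IsOpen D) (hζ : ζ ∈ D) (c : ℂ) {F : ℂ → ℂ}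
    (hF : F ∈ adSubmodule hD hζ μ n) :
    derivClass D μ (c • F) = c • derivClass D μ F := by
  rw [derivClass, derivClass, ← l2class_smul c hF.2.2]
  exact l2class_congr (ae_weightedArea_of_forall hD fun z hz =>
    deriv_const_smul c (hF.1.differentiableAt (hD.mem_nhds hz)))

/-- The map `F ↦ F'` from `AD^μ(D, ζⁿ)` to `L²_μ(D)`. -/
noncomputable def adToLp (hD : IsOpen D) (hζ : ζ ∈ D) (μ : ℂ → ℝ) (n : ℕ) :
    adSubmodule hD hζ μ n →ₗ[ℂ] Lp ℂ 2 (weightedArea D μ) where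
  toFun F := derivClass D μ F
  map_add' F G := derivClass_add hD hζ F.2 G.2
  map_smul' c F := derivClass_smul hD hζ c F.2

theorem derivClass_sub (hD : IsOpen D) (hζ : ζ ∈ D) {F G : ℂ → ℂ}
    (hF : F ∈ adSubmodule hD hζ μ n) (hG : G ∈ adSubmodule hD hζ μ n) :
    derivClass D μ (F - G) = derivClass D μ F - derivClass D μ G := by
  have h : F - G = F + (-1 : ℂ) • G := by rw [neg_one_smul, sub_eq_add_neg]
  rw [h, derivClass_add hD hζ hF (Submodule.smul_mem _ _ hG), derivClass_smul hD hζ _ hG,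
    neg_one_smul, sub_eq_add_neg]

/-- The value of the `k`-th derivative at `ζ`, as a linear functional on `AD^μ(D, ζⁿ)`. -/
noncomputable def iteratedDerivFunctional (hD : IsOpen D) (hζ : ζ ∈ D) (μ : ℂ → ℝ) (n k : ℕ) :
    adSubmodule hD hζ μ n →ₗ[ℂ] ℂ where
  toFun F := iteratedDeriv k (F : ℂ → ℂ) ζ
  map_add' F G := iteratedDeriv_add ((F.2.1.analyticAt (hD.mem_nhds hζ)).contDiffAt)
    ((G.2.1.analyticAt (hD.mem_nhds hζ)).contDiffAt)
  map_smul' c F := iteratedDeriv_const_smul ((F.2.1.analyticAt (hD.mem_nhds hζ)).contDiffAt) c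

theorem iteratedDeriv_sub_smul (hD : IsOpen D) (hζ : ζ ∈ D) {F G : ℂ → ℂ} (c : ℂ) (k : ℕ)
    (hF : F ∈ adSubmodule hD hζ μ n) (hG : G ∈ adSubmodule hD hζ μ n) :
    iteratedDeriv k (F - c • G) ζ = iteratedDeriv k F ζ - c * iteratedDeriv k G ζ := by
  have h1 := map_sub (iteratedDerivFunctional hD hζ μ n k) ⟨F, hF⟩ (c • ⟨G, hG⟩)
  rw [map_smul] at h1
  exact h1

theorem deriv_mem_bergmanSubmodule (hD : IsOpen D) (hζ : ζ ∈ D) {F : ℂ → ℂ}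
    (hF : F ∈ adSubmodule hD hζ μ n) : deriv F ∈ bergmanSubmodule D μ :=
  ⟨hF.1.deriv hD, hF.2.2⟩

theorem apply_eq_zero_of_mem_adSubmodule (hD : IsOpen D) (hζ : ζ ∈ D) (hn : 1 ≤ n) {F : ℂ → ℂ}
    (hF : F ∈ adSubmodule hD hζ μ n) : F ζ = 0 := by
  have := hF.2.1 0 hn
  rwa [iteratedDeriv_zero] at this

/-- On a closed disc in `D`, elements of the Dirichlet space oscillate at most by a multiple of
their norm. -/
theorem exists_norm_sub_le_on_closedBall (hD : IsOpen D) (hζ : ζ ∈ D) (hμ : AdmissibleWeight D μ)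
    {z : ℂ} {r : ℝ} (h : Metric.closedBall z r ⊆ D) : ∃ C : ℝ, 0 ≤ C ∧
      ∀ F ∈ adSubmodule hD hζ μ n, ∀ x ∈ Metric.closedBall z r, ∀ y ∈ Metric.closedBall z r,
        ‖F x - F y‖ ≤ C * ‖derivClass D μ F‖ := by
  obtain ⟨C, hC0, hC⟩ := exists_norm_apply_le_of_isCompact hD hμ (isCompact_closedBall z r) h
  refine ⟨C * (2 * |r|), by positivity, fun F hF x hx y hy => ?_⟩
  have h1 := (convex_closedBall z r).norm_image_sub_le_of_norm_deriv_le
    (fun w hw => hF.1.differentiableAt (hD.mem_nhds (h hw)))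
    (fun w hw => hC _ (deriv_mem_bergmanSubmodule hD hζ hF) w hw) hy hx
  have h2 : ‖x - y‖ ≤ 2 * |r| := by
    rw [← dist_eq_norm]
    have := dist_triangle_right x y z
    rw [Metric.mem_closedBall] at hx hy
    linarith [le_abs_self r]
  calc ‖F x - F y‖ ≤ C * ‖l2class D μ (deriv F)‖ * ‖x - y‖ := h1
    _ ≤ C * ‖l2class D μ (deriv F)‖ * (2 * |r|) := by gcongr
    _ = C * (2 * |r|) * ‖derivClass D μ F‖ := by rw [derivClass]; ring

/-- Point evaluations on `AD^μ(D, ζⁿ)` are locally uniformly bounded. -/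
theorem exists_norm_apply_le_on_ball (hD : IsPlanarDomain D) (hζ : ζ ∈ D)
    (hμ : AdmissibleWeight D μ) (hn : 1 ≤ n) {z : ℂ} (hz : z ∈ D) :
    ∃ r > 0, ∃ C : ℝ, 0 ≤ C ∧ ∀ F ∈ adSubmodule hD.1 hζ μ n, ∀ x ∈ Metric.ball z r,
      ‖F x‖ ≤ C * ‖derivClass D μ F‖ := by
  let u : Set ℂ := {z | ∃ r > 0, ∃ C : ℝ, 0 ≤ C ∧ ∀ F ∈ adSubmodule hD.1 hζ μ n,
    ∀ x ∈ Metric.ball z r, ‖F x‖ ≤ C * ‖derivClass D μ F‖}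
  -- A bound at one point of a small disc spreads to the whole disc, because the oscillation there
  -- is controlled by the norm of the derivative.
  have key : ∀ z ∈ D, (∀ r > 0, ∃ y' ∈ Metric.closedBall z r, ∃ C : ℝ, 0 ≤ C ∧
      ∀ F ∈ adSubmodule hD.1 hζ μ n, ‖F y'‖ ≤ C * ‖derivClass D μ F‖) → z ∈ u := by
    intro z hz hy
    obtain ⟨r, hr, hrD⟩ := Metric.nhds_basis_closedBall.mem_iff.1 (hD.1.mem_nhds hz)
    obtain ⟨C₁, hC₁, h₁⟩ := exists_norm_sub_le_on_closedBall (n := n) hD.1 hζ hμ hrD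
    obtain ⟨y, hyr, C₂, hC₂, h₂⟩ := hy r hr
    refine ⟨r, hr, C₁ + C₂, add_nonneg hC₁ hC₂, fun F hF x hx => ?_⟩
    have h3 := h₁ F hF x (Metric.ball_subset_closedBall hx) y hyr
    have h4 := h₂ F hF
    have h5 := norm_sub_norm_le (F x) (F y)
    linarith
  have hu : IsOpen u := by
    rw [Metric.isOpen_iff]
    rintro z ⟨r, hr, C, hC, h⟩
    refine ⟨r / 2, half_pos hr, fun w hw => ⟨r / 2, half_pos hr, C, hC, fun F hF x hx =>
      h F hF x ?_⟩⟩
    rw [Metric.mem_ball] at *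
    linarith [dist_triangle x w z]
  -- Connectedness: the good set is open, relatively closed by `key`, and contains `ζ`, where all
  -- the functions vanish.
  refine hD.2.isPreconnected.subset_of_closure_inter_subset hu ⟨ζ, hζ, ?_⟩ ?_ hz
  · refine key ζ hζ fun r hr => ⟨ζ, Metric.mem_closedBall_self hr.le, 0, le_rfl,
      fun F hF => ?_⟩
    rw [apply_eq_zero_of_mem_adSubmodule hD.1 hζ hn hF]
    simp
  · rintro w ⟨hw, hwD⟩
    refine key w hwD fun r hr => ?_
    obtain ⟨y, ⟨s, hs, C, hC, h⟩, hy⟩ := Metric.mem_closure_iff.1 hw r hr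
    exact ⟨y, by rw [Metric.mem_closedBall, dist_comm]; exact hy.le, C, hC,
      fun F hF => h F hF y (Metric.mem_ball_self hs)⟩

/-- Cauchy's estimate of order `k` for `F'` on a circle about `ζ`, where `F'` is bounded by its
norm. -/
theorem exists_norm_iteratedDeriv_le (hD : IsOpen D) (hζ : ζ ∈ D) (hμ : AdmissibleWeight D μ)
    (k : ℕ) : ∃ C : ℝ, 0 ≤ C ∧ ∀ F ∈ adSubmodule hD hζ μ n,
      ‖iteratedDeriv (k + 1) F ζ‖ ≤ C * ‖derivClass D μ F‖ := by
  obtain ⟨r, hr, hrD⟩ := Metric.nhds_basis_closedBall.mem_iff.1 (hD.mem_nhds hζ)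
  obtain ⟨C, hC0, hC⟩ := exists_norm_apply_le_of_isCompact hD hμ (isCompact_closedBall ζ r) hrD
  refine ⟨k.factorial * C / r ^ k, by positivity, fun F hF => ?_⟩
  rw [iteratedDeriv_succ']
  have hF' := deriv_mem_bergmanSubmodule hD hζ hF
  have h := Complex.norm_iteratedDeriv_le_of_forall_mem_sphere_norm_le k hr
    (((hF'.1.mono hrD).diffContOnCl_ball subset_rfl))
    (fun w hw => hC _ hF' w (Metric.sphere_subset_closedBall hw))
  refine h.trans_eq ?_
  rw [derivClass]
  ring

theorem tendsto_iteratedDeriv_of_tendstoLocallyUniformlyOn (hD : IsOpen D) (hζ : ζ ∈ D) (k : ℕ)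
    {F : ℕ → ℂ → ℂ} {G : ℂ → ℂ} (h : TendstoLocallyUniformlyOn F G atTop D)
    (hF : ∀ᶠ i in atTop, DifferentiableOn ℂ (F i) D) :
    Tendsto (fun i => iteratedDeriv k (F i) ζ) atTop (𝓝 (iteratedDeriv k G ζ)) := by
  induction k generalizing F G with
  | zero => simpa only [iteratedDeriv_zero] using h.tendsto_at hζ
  | succ k ih =>
    simp only [iteratedDeriv_succ']
    exact ih (h.deriv hF hD) (hF.mono fun i hi => hi.deriv hD)

/-- A sequence in `AD^μ(D, ζⁿ)` that is Cauchy converges pointwise, and the convergence is locally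
uniform. -/
theorem tendstoLocallyUniformlyOn_of_cauchySeq (hD : IsPlanarDomain D) (hζ : ζ ∈ D)
    (hμ : AdmissibleWeight D μ) (hn : 1 ≤ n) {F : ℕ → ℂ → ℂ}
    (hF : ∀ᶠ i in atTop, F i ∈ adSubmodule hD.1 hζ μ n)
    (hc : CauchySeq fun i => derivClass D μ (F i)) :
    (∀ x ∈ D, CauchySeq fun i => F i x) ∧
      ∀ G : ℂ → ℂ, (∀ x ∈ D, Tendsto (fun i => F i x) atTop (𝓝 (G x))) →
        TendstoLocallyUniformlyOn F G atTop D := by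
  have key : ∀ x ∈ D, ∃ r > 0, UniformCauchySeqOn F atTop (Metric.ball x r) := by
    intro x hx
    obtain ⟨r, hr, C, hC, h⟩ := exists_norm_apply_le_on_ball hD hζ hμ hn hx
    refine ⟨r, hr, Metric.uniformCauchySeqOn_iff.2 fun ε hε => ?_⟩
    obtain ⟨N, hN⟩ := eventually_atTop.1 hF
    -- `C + 1` replaces `C`, which may be zero.
    obtain ⟨N', hN'⟩ := Metric.cauchySeq_iff.1 hc (ε / (C + 1)) (by positivity)
    refine ⟨max N N', fun k hk l hl y hy => ?_⟩
    have hk' := hN k (le_of_max_le_left hk)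
    have hl' := hN l (le_of_max_le_left hl)
    have h1 := hN' k (le_of_max_le_right hk) l (le_of_max_le_right hl)
    rw [dist_eq_norm, ← derivClass_sub hD.1 hζ hk' hl', lt_div_iff₀ (by positivity)] at h1
    rw [dist_eq_norm]
    have h2 := h _ (sub_mem hk' hl') y hy
    rw [Pi.sub_apply] at h2
    linarith [norm_nonneg (derivClass D μ (F k - F l))]
  refine ⟨fun x hx => ?_, fun G hG u hu x hx => ?_⟩
  · obtain ⟨r, hr, h⟩ := key x hx
    exact h.cauchySeq (Metric.mem_ball_self hr)
  · obtain ⟨r, hr, h⟩ := key x hx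
    refine ⟨Metric.ball x r ∩ D, inter_mem (mem_nhdsWithin_of_mem_nhds (Metric.ball_mem_nhds x hr))
      self_mem_nhdsWithin, ?_⟩
    exact (UniformCauchySeqOn.tendstoUniformlyOn_of_tendsto (h.mono Set.inter_subset_left)
      fun y hy => hG y hy.2) u hu

/-- Convergence in `AD^μ(D, ζⁿ)` implies locally uniform convergence. -/
theorem tendstoLocallyUniformlyOn_of_tendsto_derivClass (hD : IsPlanarDomain D) (hζ : ζ ∈ D)
    (hμ : AdmissibleWeight D μ) (hn : 1 ≤ n) {F : ℕ → ℂ → ℂ} {G : ℂ → ℂ}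
    (hF : ∀ᶠ i in atTop, F i ∈ adSubmodule hD.1 hζ μ n) (hG : G ∈ adSubmodule hD.1 hζ μ n)
    (h : Tendsto (fun i => ‖derivClass D μ (F i) - derivClass D μ G‖) atTop (𝓝 0)) :
    TendstoLocallyUniformlyOn F G atTop D := by
  refine (tendstoLocallyUniformlyOn_of_cauchySeq hD hζ hμ hn hF
    (tendsto_iff_norm_sub_tendsto_zero.2 h).cauchySeq).2 G fun x hx => ?_
  obtain ⟨r, hr, C, hC, hb⟩ := exists_norm_apply_le_on_ball hD hζ hμ hn hx
  rw [tendsto_iff_norm_sub_tendsto_zero]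
  refine squeeze_zero' (Eventually.of_forall fun _ => norm_nonneg _)
    (hF.mono fun i hi => ?_) (by simpa using h.const_mul C)
  rw [← derivClass_sub hD.1 hζ hi hG]
  exact hb _ (sub_mem hi hG) x (Metric.mem_ball_self hr)

/-- The derivatives of the elements of `AD^μ(D, ζⁿ)`, as a subspace of `L²_μ(D)`. -/
noncomputable def adLp (hD : IsOpen D) (hζ : ζ ∈ D) (μ : ℂ → ℝ) (n : ℕ) :
    Submodule ℂ (Lp ℂ 2 (weightedArea D μ)) := LinearMap.range (adToLp hD hζ μ n)

theorem derivClass_mem_adLp (hD : IsOpen D) (hζ : ζ ∈ D) {F : ℂ → ℂ}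
    (hF : F ∈ adSubmodule hD hζ μ n) : derivClass D μ F ∈ adLp hD hζ μ n := ⟨⟨F, hF⟩, rfl⟩

/-- A limit of derivatives is a Bergman function `f`. The primitives, normalised at `ζ`, converge
locally uniformly to some `G`, and bounded evaluation of the derivatives forces `f = G'`; the
vanishing conditions pass to the limit. -/
theorem isClosed_adLp (hD : IsPlanarDomain D) (hζ : ζ ∈ D) (hμ : AdmissibleWeight D μ)
    (hn : 1 ≤ n) : IsClosed (adLp hD.1 hζ μ n : Set (Lp ℂ 2 (weightedArea D μ))) := by
  refine isClosed_of_closure_subset fun g hg => ?_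
  obtain ⟨v, hv, hvg⟩ := mem_closure_iff_seq_limit.1 hg
  choose F hF using hv
  have hFv : ∀ i, derivClass D μ (F i : ℂ → ℂ) = v i := hF
  obtain ⟨f, hf⟩ : g ∈ bergmanLp D μ := (isClosed_bergmanLp hD.1 hμ).mem_of_tendsto hvg
    (Eventually.of_forall fun i =>
      ⟨⟨deriv (F i : ℂ → ℂ), deriv_mem_bergmanSubmodule hD.1 hζ (F i).2⟩, hF i⟩)
  have hF' : ∀ᶠ i in atTop, (F i : ℂ → ℂ) ∈ adSubmodule hD.1 hζ μ n :=
    Eventually.of_forall fun i => (F i).2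
  have hd : ∀ᶠ i in atTop, DifferentiableOn ℂ (F i : ℂ → ℂ) D := hF'.mono fun i hi => hi.1
  obtain ⟨h1, h2⟩ := tendstoLocallyUniformlyOn_of_cauchySeq hD hζ hμ hn hF'
    (by simpa only [hFv] using hvg.cauchySeq)
  choose! G hG using fun x hx => cauchySeq_tendsto_of_complete (h1 x hx)
  have hTL := h2 G hG
  have hGd := hTL.differentiableOn hd hD.1
  have hfG : ∀ z ∈ D, (f : ℂ → ℂ) z = deriv G z := by
    intro z hz
    obtain ⟨k, hk⟩ := exists_inner_eq_apply hD.1 hμ hz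
    have h3 : Tendsto (fun i => inner ℂ k (v i)) atTop (𝓝 (inner ℂ k g)) :=
      tendsto_const_nhds.inner hvg
    rw [← hf] at h3
    change Tendsto _ _ (𝓝 (inner ℂ k (l2class D μ f))) at h3
    rw [hk f f.2] at h3
    refine tendsto_nhds_unique h3 (((hTL.deriv hd hD.1).tendsto_at hz).congr fun i => ?_)
    rw [← hF i]
    exact (hk _ (deriv_mem_bergmanSubmodule hD.1 hζ (F i).2)).symm
  have hae : (f : ℂ → ℂ) =ᵐ[weightedArea D μ] deriv G := ae_weightedArea_of_forall hD.1 hfG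
  refine ⟨⟨G, hGd, fun k hk => ?_, f.2.2.ae_eq hae⟩, ?_⟩
  · refine tendsto_nhds_unique
      (tendsto_iteratedDeriv_of_tendstoLocallyUniformlyOn hD.1 hζ k hTL hd) ?_
    exact tendsto_const_nhds.congr fun i => ((F i).2.2.1 k hk).symm
  · rw [← hf]
    exact l2class_congr hae.symm

theorem adInner_eq_inner (hD : IsOpen D) (hζ : ζ ∈ D) (hμ : AdmissibleWeight D μ) {F G : ℂ → ℂ}
    (hF : F ∈ adSubmodule hD hζ μ n) (hG : G ∈ adSubmodule hD hζ μ n) :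
    adInner D μ F G = inner ℂ (derivClass D μ G) (derivClass D μ F) :=
  (inner_l2class hD hμ hF.2.2 hG.2.2).symm

theorem isKernelFunction_iff (hD : IsOpen D) (hζ : ζ ∈ D) (hμ : AdmissibleWeight D μ)
    {M : ℂ → ℂ} : IsKernelFunction D μ n ζ M ↔ M ∈ adSubmodule hD hζ μ n ∧
      ∀ F ∈ adSubmodule hD hζ μ n,
        inner ℂ (derivClass D μ M) (derivClass D μ F) = iteratedDeriv n F ζ := by
  rw [IsKernelFunction, ← mem_adSubmodule_iff hD hζ hμ]
  refine and_congr_right fun hM => forall_congr' fun F => ?_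
  rw [← mem_adSubmodule_iff hD hζ hμ]
  refine forall_congr' fun hF => ?_
  rw [adInner_eq_inner hD hζ hμ hF hM, eq_comm]

/-- Bounded functionals on `AD^μ(D, ζⁿ)` are represented by elements of the space. -/
theorem exists_mem_adSubmodule_inner_eq (hD : IsPlanarDomain D) (hζ : ζ ∈ D)
    (hμ : AdmissibleWeight D μ) (hn : 1 ≤ n) (v : Lp ℂ 2 (weightedArea D μ)) :
    ∃ M ∈ adSubmodule hD.1 hζ μ n, ∀ F ∈ adSubmodule hD.1 hζ μ n,
      inner ℂ (derivClass D μ M) (derivClass D μ F) = inner ℂ v (derivClass D μ F) := by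
  have : CompleteSpace (adLp hD.1 hζ μ n) := (isClosed_adLp hD hζ hμ hn).completeSpace_coe
  obtain ⟨M, hM⟩ : (adLp hD.1 hζ μ n).starProjection v ∈ adLp hD.1 hζ μ n :=
    Submodule.starProjection_apply_mem _ _
  refine ⟨M, M.2, fun F hF => ?_⟩
  have h1 : derivClass D μ M = (adLp hD.1 hζ μ n).starProjection v := hM
  rw [h1, Submodule.inner_starProjection_left_eq_right,
    Submodule.starProjection_eq_self_iff.2 (derivClass_mem_adLp hD.1 hζ hF)]

/-- Cauchy's estimate bounds the functional, giving a Riesz vector in `L²_μ(D)`; its projection to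
the closed space of derivatives is the derivative of the kernel. -/
theorem exists_isKernelFunction (hD : IsPlanarDomain D) (hζ : ζ ∈ D)
    (hμ : AdmissibleWeight D μ) (hn : 1 ≤ n) : ∃ M, IsKernelFunction D μ n ζ M := by
  obtain ⟨C, -, hC⟩ := exists_norm_iteratedDeriv_le (n := n) hD.1 hζ hμ (n - 1)
  rw [Nat.sub_add_cancel hn] at hC
  obtain ⟨k, hk⟩ := exists_inner_eq_of_norm_le (adToLp hD.1 hζ μ n)
    (iteratedDerivFunctional hD.1 hζ μ n n) C fun F => hC F F.2
  obtain ⟨M, hM, h⟩ := exists_mem_adSubmodule_inner_eq hD hζ hμ hn k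
  exact ⟨M, (isKernelFunction_iff hD.1 hζ hμ).2 ⟨hM, fun F hF => (h F hF).trans (hk ⟨F, hF⟩)⟩⟩

theorem isKernelFunction_kernelM (hD : IsPlanarDomain D) (hζ : ζ ∈ D)
    (hμ : AdmissibleWeight D μ) (hn : 1 ≤ n) :
    IsKernelFunction D μ n ζ (kernelM D μ n ζ) := by
  have h := exists_isKernelFunction hD hζ hμ hn
  rw [kernelM, dif_pos h]
  exact h.choose_spec

theorem eqOn_of_derivClass_eq (hD : IsPlanarDomain D) (hζ : ζ ∈ D) (hμ : AdmissibleWeight D μ)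
    (hn : 1 ≤ n) {F G : ℂ → ℂ} (hF : F ∈ adSubmodule hD.1 hζ μ n)
    (hG : G ∈ adSubmodule hD.1 hζ μ n) (h : derivClass D μ F = derivClass D μ G) :
    Set.EqOn F G D := by
  intro x hx
  obtain ⟨r, hr, C, -, hb⟩ := exists_norm_apply_le_on_ball hD hζ hμ hn hx
  have h1 := hb _ (sub_mem hF hG) x (Metric.mem_ball_self hr)
  rw [derivClass_sub hD.1 hζ hF hG, h, sub_self, norm_zero, mul_zero] at h1
  exact sub_eq_zero.1 (norm_le_zero_iff.1 h1)

theorem IsKernelFunction.eqOn (hD : IsPlanarDomain D) (hζ : ζ ∈ D)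
    (hμ : AdmissibleWeight D μ) (hn : 1 ≤ n) {M N : ℂ → ℂ} (hM : IsKernelFunction D μ n ζ M)
    (hN : IsKernelFunction D μ n ζ N) : Set.EqOn M N D := by
  rw [isKernelFunction_iff hD.1 hζ hμ] at hM hN
  refine eqOn_of_derivClass_eq hD hζ hμ hn hM.1 hN.1 (sub_eq_zero.1 ?_)
  have h := hM.2 _ (sub_mem hM.1 hN.1)
  rw [← hN.2 _ (sub_mem hM.1 hN.1), ← sub_eq_zero, ← inner_sub_left,
    derivClass_sub hD.1 hζ hM.1 hN.1, inner_self_eq_zero] at h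
  exact h

theorem norm_sq_derivClass_kernel (hD : IsOpen D) (hζ : ζ ∈ D) (hμ : AdmissibleWeight D μ)
    {M : ℂ → ℂ} (hM : IsKernelFunction D μ n ζ M) :
    ((‖derivClass D μ M‖ ^ 2 : ℝ) : ℂ) = iteratedDeriv n M ζ := by
  rw [isKernelFunction_iff hD hζ hμ] at hM
  rw [← hM.2 M hM.1, inner_self_eq_norm_sq_to_K]
  simp

/-- The cross term of the expanded square is evaluated by the reproducing property, so the distance
to the kernel depends only on two norms and one derivative. -/
theorem norm_sq_derivClass_sub_kernel (hD : IsOpen D) (hζ : ζ ∈ D) (hμ : AdmissibleWeight D μ)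
    {F M : ℂ → ℂ} (hF : F ∈ adSubmodule hD hζ μ n) (hM : IsKernelFunction D μ n ζ M) :
    ‖derivClass D μ F - derivClass D μ M‖ ^ 2 =
      ‖derivClass D μ F‖ ^ 2 - 2 * (iteratedDeriv n F ζ).re + ‖derivClass D μ M‖ ^ 2 := by
  rw [isKernelFunction_iff hD hζ hμ] at hM
  rw [@norm_sub_sq ℂ, ← inner_conj_symm, hM.2 F hF]
  simp

/-- Cauchy–Schwarz: the norm of the kernel bounds the functional it represents. -/
theorem norm_iteratedDeriv_le_norm_kernel (hD : IsOpen D) (hζ : ζ ∈ D)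
    (hμ : AdmissibleWeight D μ) {F M : ℂ → ℂ} (hF : F ∈ adSubmodule hD hζ μ n)
    (hM : IsKernelFunction D μ n ζ M) :
    ‖iteratedDeriv n F ζ‖ ≤ ‖derivClass D μ M‖ * ‖derivClass D μ F‖ := by
  rw [isKernelFunction_iff hD hζ hμ] at hM
  rw [← hM.2 F hF]
  exact norm_inner_le_norm _ _

end ReducedBergman

/-! ### Monotonicity in the domain and the weight -/

namespace ReducedBergman

variable {D G : Set ℂ} {μ ν : ℂ → ℝ} {n : ℕ} {ζ : ℂ}

theorem weightedArea_mono (hD : IsOpen D) (hG : IsOpen G) (hDG : D ⊆ G)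
    (h : ∀ z ∈ D, μ z ≤ ν z) : weightedArea D μ ≤ weightedArea G ν := by
  calc weightedArea D μ ≤ weightedArea D ν := withDensity_mono
        (ae_restrict_of_forall_mem hD.measurableSet fun z hz => ENNReal.ofReal_le_ofReal (h z hz))
    _ ≤ weightedArea G ν := by
      rw [weightedArea, weightedArea, ← restrict_withDensity hD.measurableSet,
        ← restrict_withDensity hG.measurableSet]
      exact Measure.restrict_mono_set _ hDG

theorem mem_adSubmodule_of_subset (hD : IsOpen D) (hG : IsOpen G) (hDG : D ⊆ G)
    (h : ∀ z ∈ D, μ z ≤ ν z) (hζ : ζ ∈ D) {F : ℂ → ℂ}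
    (hF : F ∈ adSubmodule hG (hDG hζ) ν n) : F ∈ adSubmodule hD hζ μ n :=
  ⟨hF.1.mono hDG, hF.2.1, hF.2.2.mono_measure (weightedArea_mono hD hG hDG h)⟩

theorem norm_derivClass_le_of_subset (hD : IsOpen D) (hG : IsOpen G) (hDG : D ⊆ G)
    (h : ∀ z ∈ D, μ z ≤ ν z) (hζ : ζ ∈ D) {F : ℂ → ℂ}
    (hF : F ∈ adSubmodule hG (hDG hζ) ν n) : ‖derivClass D μ F‖ ≤ ‖derivClass G ν F‖ := by
  rw [derivClass, derivClass, l2class_of_memLp hF.2.2,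
    l2class_of_memLp (mem_adSubmodule_of_subset hD hG hDG h hζ hF).2.2, Lp.norm_toLp, Lp.norm_toLp]
  exact ENNReal.toReal_mono hF.2.2.eLpNorm_ne_top
    (eLpNorm_mono_measure _ (weightedArea_mono hD hG hDG h))

/-- Comparison of the kernel functions of a domain and of a subdomain with a smaller weight. -/
theorem norm_sq_kernel_sub_kernel_le (hD : IsOpen D) (hG : IsOpen G) (hμ : AdmissibleWeight D μ)
    (hν : AdmissibleWeight G ν) (hDG : D ⊆ G) (h : ∀ z ∈ D, μ z ≤ ν z) (hζ : ζ ∈ D)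
    {M N : ℂ → ℂ} (hM : IsKernelFunction D μ n ζ M) (hN : IsKernelFunction G ν n ζ N) :
    ‖derivClass D μ N - derivClass D μ M‖ ^ 2 ≤
      ‖derivClass D μ M‖ ^ 2 - ‖derivClass G ν N‖ ^ 2 := by
  have hN' := (mem_adSubmodule_iff hG (hDG hζ) hν).2 hN.1
  rw [norm_sq_derivClass_sub_kernel hD hζ hμ (mem_adSubmodule_of_subset hD hG hDG h hζ hN') hM,
    ← norm_sq_derivClass_kernel hG (hDG hζ) hν hN, Complex.ofReal_re]
  have := pow_le_pow_left₀ (norm_nonneg _) (norm_derivClass_le_of_subset hD hG hDG h hζ hN') 2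
  linarith

theorem norm_sq_kernel_le_of_subset (hD : IsOpen D) (hG : IsOpen G) (hμ : AdmissibleWeight D μ)
    (hν : AdmissibleWeight G ν) (hDG : D ⊆ G) (h : ∀ z ∈ D, μ z ≤ ν z) (hζ : ζ ∈ D)
    {M N : ℂ → ℂ} (hM : IsKernelFunction D μ n ζ M) (hN : IsKernelFunction G ν n ζ N) :
    ‖derivClass G ν N‖ ^ 2 ≤ ‖derivClass D μ M‖ ^ 2 :=
  sub_nonneg.1 ((sq_nonneg _).trans
    (norm_sq_kernel_sub_kernel_le hD hG hμ hν hDG h hζ hM hN))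

theorem tendsto_norm_zero_of_sq_le {E : Type*} [SeminormedAddCommGroup E] {u : ℕ → E} {a : ℕ → ℝ}
    (h : ∀ᶠ i in atTop, ‖u i‖ ^ 2 ≤ a i) (ha : Tendsto a atTop (𝓝 0)) :
    Tendsto (fun i => ‖u i‖) atTop (𝓝 0) := by
  have h1 : Tendsto (fun i => ‖u i‖ ^ 2) atTop (𝓝 0) :=
    squeeze_zero' (Eventually.of_forall fun _ => sq_nonneg _) h ha
  have h2 := h1.sqrt
  simpa only [Real.sqrt_sq (norm_nonneg _), Real.sqrt_zero] using h2

theorem lintegral_deriv_eq (hD : IsOpen D) (hζ : ζ ∈ D) (hμ : AdmissibleWeight D μ) {F : ℂ → ℂ}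
    (hF : F ∈ adSubmodule hD hζ μ n) :
    ∫⁻ z in D, ENNReal.ofReal (‖deriv F z‖ ^ 2 * μ z) =
      ENNReal.ofReal (‖derivClass D μ F‖ ^ 2) := by
  rw [derivClass, norm_sq_l2class hD hμ hF.2.2, ofReal_integral_eq_lintegral_ofReal]
  · exact ((mem_adSubmodule_iff hD hζ hμ).1 hF).2.2
  · exact ae_restrict_of_forall_mem hD.measurableSet fun z hz =>
      mul_nonneg (sq_nonneg _) (hμ.pos z hz).le

theorem aemeasurable_norm_deriv_sq (hD : IsOpen D) (hμ : AdmissibleWeight D μ) {F : ℂ → ℂ}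
    (hF : DifferentiableOn ℂ F D) :
    AEMeasurable (fun z => ‖deriv F z‖ ^ 2 * μ z) (volume.restrict D) :=
  (((aestronglyMeasurable_of_differentiableOn hD (hF.deriv hD)).norm.aemeasurable).pow_const 2).mul
    hμ.measurable

/-- Serves for limits produced by Fatou's lemma, whose square integrability is not known beforehand.
-/
theorem norm_sq_derivClass_le_of_lintegral_le (hD : IsOpen D) (hζ : ζ ∈ D)
    (hμ : AdmissibleWeight D μ) {F : ℂ → ℂ} (hF : DifferentiableOn ℂ F D)
    (h0 : ∀ k < n, iteratedDeriv k F ζ = 0) {L : ℝ} (hL : 0 ≤ L)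
    (h : ∫⁻ z in D, ENNReal.ofReal (‖deriv F z‖ ^ 2 * μ z) ≤ ENNReal.ofReal L) :
    F ∈ adSubmodule hD hζ μ n ∧ ‖derivClass D μ F‖ ^ 2 ≤ L := by
  have hF' : F ∈ adSubmodule hD hζ μ n := by
    refine (mem_adSubmodule_iff hD hζ hμ).2 ⟨hF, h0,
      (aemeasurable_norm_deriv_sq hD hμ hF).aestronglyMeasurable, ?_⟩
    rw [hasFiniteIntegral_iff_ofReal (ae_restrict_of_forall_mem hD.measurableSet fun z hz =>
      mul_nonneg (sq_nonneg _) (hμ.pos z hz).le)]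
    exact h.trans_lt ENNReal.ofReal_lt_top
  refine ⟨hF', ?_⟩
  rwa [lintegral_deriv_eq hD hζ hμ hF', ENNReal.ofReal_le_ofReal_iff hL] at h

theorem tendstoLocallyUniformlyOn_of_forall_exists_isOpen {F : ℕ → ℂ → ℂ} {f : ℂ → ℂ}
    (h : ∀ x ∈ D, ∃ U, IsOpen U ∧ x ∈ U ∧ TendstoLocallyUniformlyOn F f atTop U) :
    TendstoLocallyUniformlyOn F f atTop D := by
  intro u hu x hx
  obtain ⟨U, hU, hxU, hT⟩ := h x hx
  obtain ⟨t, ht, h'⟩ := hT u hu x hxU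
  rw [hU.nhdsWithin_eq hxU] at ht
  exact ⟨t, mem_nhdsWithin_of_mem_nhds ht, h'⟩

/-! ### Exhausting sequences of domains -/

section Union

variable {Ω : ℕ → Set ℂ} {w : ℕ → ℂ → ℝ} {M : ℕ → ℂ → ℂ} {N : ℂ → ℂ} {j : ℕ → ℕ}

/-- Fatou's lemma for the Dirichlet integrals over an exhausting sequence of domains. -/
theorem norm_sq_derivClass_le_of_tendsto (hD : IsOpen D) (hζ : ζ ∈ D) (hμ : AdmissibleWeight D μ)
    (hΩ : ∀ i, IsOpen (Ω i)) (hw : ∀ i, AdmissibleWeight (Ω i) (w i)) (hΩD : ∀ i, Ω i ⊆ D)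
    (hζΩ : ∀ i, ζ ∈ Ω i) (hev : ∀ z ∈ D, ∀ᶠ k in atTop, z ∈ Ω k)
    (hlim : ∀ᵐ z ∂(volume.restrict D), Tendsto (fun i => w i z) atTop (𝓝 (μ z)))
    (hM : ∀ i, M i ∈ adSubmodule (hΩ i) (hζΩ i) (w i) n)
    {g : ℂ → ℂ} (hg : DifferentiableOn ℂ g D) (h0 : ∀ k < n, iteratedDeriv k g ζ = 0)
    (hd : ∀ z ∈ D, Tendsto (fun k => deriv (M k) z) atTop (𝓝 (deriv g z)))
    {L : ℝ} (hL : Tendsto (fun i => ‖derivClass (Ω i) (w i) (M i)‖ ^ 2) atTop (𝓝 L)) :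
    g ∈ adSubmodule hD hζ μ n ∧ ‖derivClass D μ g‖ ^ 2 ≤ L := by
  refine norm_sq_derivClass_le_of_lintegral_le hD hζ hμ hg h0
    (ge_of_tendsto' hL fun _ => sq_nonneg _) ?_
  -- Extension by zero puts all integrands on `D`; each point is eventually in `Ω k`, so pointwise
  -- limits are unaffected.
  let φ : ℕ → ℂ → ENNReal := fun k =>
    (Ω k).indicator fun z => ENNReal.ofReal (‖deriv (M k) z‖ ^ 2 * w k z)
  have hφ : ∀ k, ∫⁻ z in D, φ k z = ENNReal.ofReal (‖derivClass (Ω k) (w k) (M k)‖ ^ 2) := by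
    intro k
    rw [← lintegral_deriv_eq (hΩ k) (hζΩ k) (hw k) (hM k),
      lintegral_indicator (hΩ k).measurableSet, Measure.restrict_restrict (hΩ k).measurableSet,
      Set.inter_eq_left.2 (hΩD k)]
  have hmeas : ∀ k, AEMeasurable (φ k) (volume.restrict D) := by
    intro k
    rw [aemeasurable_indicator_iff (hΩ k).measurableSet,
      Measure.restrict_restrict (hΩ k).measurableSet, Set.inter_eq_left.2 (hΩD k)]
    exact (aemeasurable_norm_deriv_sq (hΩ k) (hw k) (hM k).1).ennreal_ofReal
  calc ∫⁻ z in D, ENNReal.ofReal (‖deriv g z‖ ^ 2 * μ z)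
      = ∫⁻ z in D, liminf (fun k => φ k z) atTop := by
        refine lintegral_congr_ae ?_
        filter_upwards [hlim, ae_restrict_mem hD.measurableSet] with z hz hzD
        refine (Tendsto.liminf_eq ?_).symm
        refine (ENNReal.tendsto_ofReal (((hd z hzD).norm.pow 2).mul hz)).congr' ?_
        filter_upwards [hev z hzD] with k hk
        exact (Set.indicator_of_mem hk
          fun z => ENNReal.ofReal (‖deriv (M k) z‖ ^ 2 * w k z)).symm
    _ ≤ liminf (fun k => ∫⁻ z in D, φ k z) atTop := lintegral_liminf_le' hmeas
    _ = ENNReal.ofReal L := by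
        simp only [hφ]
        exact (ENNReal.tendsto_ofReal hL).liminf_eq

/-- The sequence need not be monotone: once a term is close to the infimum, all terms from its own
threshold on are at least as small. -/
theorem tendsto_of_eventually_antitone {a : ℕ → ℝ} (ha : ∀ i, 0 ≤ a i)
    (h : ∀ i k, j i ≤ k → a k ≤ a i) : Tendsto a atTop (𝓝 (⨅ i, a i)) := by
  have hb : BddBelow (Set.range a) := ⟨0, by rintro _ ⟨i, rfl⟩; exact ha i⟩
  refine tendsto_order.2 ⟨fun b hb' => Eventually.of_forall fun i => hb'.trans_le (ciInf_le hb i),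
    fun b hb' => ?_⟩
  obtain ⟨i, hi⟩ := exists_lt_of_ciInf_lt hb'
  exact eventually_atTop.2 ⟨j i, fun k hk => (h i k hk).trans_lt hi⟩

/-- The kernel functions of an exhausting sequence of domains, with weights increasing to the
weight of the union, converge, if the base point lies in all the domains. -/
theorem tendstoLocallyUniformlyOn_kernel_of_exhaustion (hD : IsPlanarDomain D)
    (hμ : AdmissibleWeight D μ) (hΩ : ∀ i, IsPlanarDomain (Ω i))
    (hw : ∀ i, AdmissibleWeight (Ω i) (w i)) (hn : 1 ≤ n) (hζΩ : ∀ i, ζ ∈ Ω i)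
    (hΩD : ∀ i, Ω i ⊆ D) (hcov : ∀ z ∈ D, ∃ i, z ∈ Ω i)
    (hsub : ∀ i k, j i ≤ k → Ω i ⊆ Ω k) (hmono : ∀ i k, j i ≤ k → ∀ z ∈ Ω i, w i z ≤ w k z)
    (hle : ∀ i, ∀ z ∈ Ω i, w i z ≤ μ z)
    (hlim : ∀ᵐ z ∂(volume.restrict D), Tendsto (fun i => w i z) atTop (𝓝 (μ z)))
    (hM : ∀ i, IsKernelFunction (Ω i) (w i) n ζ (M i)) (hN : IsKernelFunction D μ n ζ N) :
    TendstoLocallyUniformlyOn M N atTop D := by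
  have hζ : ζ ∈ D := hΩD 0 (hζΩ 0)
  have hM' : ∀ i, M i ∈ adSubmodule (hΩ i).1 (hζΩ i) (w i) n := fun i =>
    (mem_adSubmodule_iff (hΩ i).1 (hζΩ i) (hw i)).2 (hM i).1
  have hN' := (mem_adSubmodule_iff hD.1 hζ hμ).2 hN.1
  set a : ℕ → ℝ := fun i => ‖derivClass (Ω i) (w i) (M i)‖ ^ 2 with ha
  have hMi : ∀ i k, j i ≤ k → M k ∈ adSubmodule (hΩ i).1 (hζΩ i) (w i) n := fun i k hk =>
    mem_adSubmodule_of_subset (hΩ i).1 (hΩ k).1 (hsub i k hk) (hmono i k hk) (hζΩ i) (hM' k)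
  have hMiev : ∀ i, ∀ᶠ k in atTop, M k ∈ adSubmodule (hΩ i).1 (hζΩ i) (w i) n := fun i =>
    eventually_atTop.2 ⟨j i, hMi i⟩
  have hdiff : ∀ i k, j i ≤ k → ‖derivClass (Ω i) (w i) (M k) - derivClass (Ω i) (w i) (M i)‖ ^ 2 ≤
      a i - a k := fun i k hk => norm_sq_kernel_sub_kernel_le (hΩ i).1 (hΩ k).1 (hw i) (hw k)
        (hsub i k hk) (hmono i k hk) (hζΩ i) (hM i) (hM k)
  have haL := tendsto_of_eventually_antitone (a := a) (fun i => sq_nonneg _)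
    fun i k hk => sub_nonneg.1 ((sq_nonneg _).trans (hdiff i k hk))
  have haLe : ∀ i, (⨅ i, a i) ≤ a i :=
    ciInf_le ⟨0, by rintro _ ⟨i, rfl⟩; exact sq_nonneg _⟩
  set L : ℝ := ⨅ i, a i
  have hev : ∀ z ∈ D, ∀ᶠ k in atTop, z ∈ Ω k := fun z hz => by
    obtain ⟨i, hi⟩ := hcov z hz
    exact eventually_atTop.2 ⟨j i, fun k hk => hsub i k hk hi⟩
  have hcauchy : ∀ i, CauchySeq fun k => derivClass (Ω i) (w i) (M k) := by
    intro i
    rw [Metric.cauchySeq_iff]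
    intro ε hε
    -- With `a k < L + (ε/2)²`, every later kernel is within `ε/2` of `M k` in the norm of `Ω k`, as
    -- `a k - a l ≤ a k - L`. Restriction to `Ω i` does not increase the distance.
    obtain ⟨k, hk1, hk2⟩ := ((haL.eventually_lt_const
      (lt_add_of_pos_right L (by positivity : 0 < (ε / 2) ^ 2))).and
        (eventually_ge_atTop (j i))).exists
    have hkl : ∀ l, j k ≤ l → j i ≤ l →
        dist (derivClass (Ω i) (w i) (M l)) (derivClass (Ω i) (w i) (M k)) < ε / 2 := by
      intro l hl hil
      have h1 : derivClass (Ω i) (w i) (M l) - derivClass (Ω i) (w i) (M k) =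
        derivClass (Ω i) (w i) (M l - M k) :=
          (derivClass_sub (hΩ i).1 (hζΩ i) (hMi i l hil) (hMi i k hk2)).symm
      rw [dist_eq_norm, h1]
      have h2 := norm_derivClass_le_of_subset (hΩ i).1 (hΩ k).1 (hsub i k hk2) (hmono i k hk2)
        (hζΩ i) (sub_mem (hMi k l hl) (hM' k))
      refine h2.trans_lt (lt_of_pow_lt_pow_left₀ 2 (by positivity) ?_)
      rw [derivClass_sub (hΩ k).1 (hζΩ k) (hMi k l hl) (hM' k)]
      linarith [hdiff k l hl, haLe l]
    refine ⟨max (j k) (j i), fun l hl l' hl' => ?_⟩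
    have h1 := hkl l (le_of_max_le_left hl) (le_of_max_le_right hl)
    have h2 := hkl l' (le_of_max_le_left hl') (le_of_max_le_right hl')
    linarith [dist_triangle_right (derivClass (Ω i) (w i) (M l)) (derivClass (Ω i) (w i) (M l'))
      (derivClass (Ω i) (w i) (M k))]
  have hptw : ∀ z ∈ D, ∃ y, Tendsto (fun k => M k z) atTop (𝓝 y) := fun z hz => by
    obtain ⟨i, hi⟩ := hcov z hz
    exact cauchySeq_tendsto_of_complete ((tendstoLocallyUniformlyOn_of_cauchySeq (hΩ i) (hζΩ i)
      (hw i) hn (hMiev i) (hcauchy i)).1 z hi)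
  choose! g hg using hptw
  have hTL : ∀ i, TendstoLocallyUniformlyOn M g atTop (Ω i) := fun i =>
    (tendstoLocallyUniformlyOn_of_cauchySeq (hΩ i) (hζΩ i) (hw i) hn (hMiev i) (hcauchy i)).2 g
      fun z hz => hg z (hΩD i hz)
  have hdi : ∀ i, ∀ᶠ k in atTop, DifferentiableOn ℂ (M k) (Ω i) := fun i =>
    (hMiev i).mono fun k hk => hk.1
  have hgd : DifferentiableOn ℂ g D := fun z hz => by
    obtain ⟨i, hi⟩ := hcov z hz
    exact (((hTL i).differentiableOn (hdi i) (hΩ i).1).differentiableAt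
      ((hΩ i).1.mem_nhds hi)).differentiableWithinAt
  have hgk : ∀ k, Tendsto (fun i => iteratedDeriv k (M i) ζ) atTop (𝓝 (iteratedDeriv k g ζ)) :=
    fun k => tendsto_iteratedDeriv_of_tendstoLocallyUniformlyOn (hΩ 0).1 (hζΩ 0) k (hTL 0) (hdi 0)
  obtain ⟨hgm, hgL⟩ := norm_sq_derivClass_le_of_tendsto hD.1 hζ hμ (fun i => (hΩ i).1) hw hΩD hζΩ
    hev hlim hM' hgd (fun k hk => tendsto_nhds_unique (hgk k)
      (tendsto_const_nhds.congr fun i => ((hM' i).2.1 k hk).symm))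
    (fun z hz => by
      obtain ⟨i, hi⟩ := hcov z hz
      exact ((hTL i).deriv (hdi i) (hΩ i).1).tendsto_at hi) haL
  -- The identity between squared norm and `n`-th derivative of a kernel passes to the limit.
  have hLn : (L : ℂ) = iteratedDeriv n g ζ := by
    refine tendsto_nhds_unique ?_ (hgk n)
    refine ((Complex.continuous_ofReal.tendsto L).comp haL).congr fun i => ?_
    exact norm_sq_derivClass_kernel (hΩ i).1 (hζΩ i) (hw i) (hM i)
  have hL0 : 0 ≤ L := ge_of_tendsto' haL fun _ => sq_nonneg _
  have hNa : ∀ i, ‖derivClass (Ω i) (w i) N - derivClass (Ω i) (w i) (M i)‖ ^ 2 ≤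
      a i - ‖derivClass D μ N‖ ^ 2 := fun i => norm_sq_kernel_sub_kernel_le (hΩ i).1 hD.1 (hw i) hμ
        (hΩD i) (hle i) (hζΩ i) (hM i) hN
  -- Cauchy–Schwarz and Fatou give `L² ≤ ‖N'‖² ‖g'‖² ≤ ‖N'‖² L`; the other inequality is
  -- monotonicity of the norms.
  have hLN : L = ‖derivClass D μ N‖ ^ 2 := by
    refine le_antisymm ?_ (ge_of_tendsto' haL fun i =>
      sub_nonneg.1 ((sq_nonneg _).trans (hNa i)))
    have h1 := norm_iteratedDeriv_le_norm_kernel hD.1 hζ hμ hgm hN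
    rw [← hLn, Complex.norm_real, Real.norm_of_nonneg hL0] at h1
    have h2 : L ^ 2 ≤ ‖derivClass D μ N‖ ^ 2 * L :=
      (pow_le_pow_left₀ hL0 h1 2).trans (by
        rw [mul_pow]
        exact mul_le_mul_of_nonneg_left hgL (sq_nonneg _))
    rcases hL0.eq_or_lt with h | h
    · rw [← h]
      exact sq_nonneg _
    · rw [sq] at h2
      exact le_of_mul_le_mul_right h2 h
  refine tendstoLocallyUniformlyOn_of_forall_exists_isOpen fun z hz => ?_
  obtain ⟨i, hi⟩ := hcov z hz
  refine ⟨Ω i, (hΩ i).1, hi, ?_⟩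
  have hNk : ∀ k, N ∈ adSubmodule (hΩ k).1 (hζΩ k) (w k) n := fun k =>
    mem_adSubmodule_of_subset (hΩ k).1 hD.1 (hΩD k) (hle k) (hζΩ k) hN'
  refine tendstoLocallyUniformlyOn_of_tendsto_derivClass (hΩ i) (hζΩ i) (hw i) hn (hMiev i)
    (hNk i) (tendsto_norm_zero_of_sq_le (a := fun k => a k - ‖derivClass D μ N‖ ^ 2)
      (eventually_atTop.2 ⟨j i, fun k hk => ?_⟩) ?_)
  · rw [← derivClass_sub (hΩ i).1 (hζΩ i) (hMi i k hk) (hNk i)]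
    refine (pow_le_pow_left₀ (norm_nonneg _) (norm_derivClass_le_of_subset (hΩ i).1 (hΩ k).1
      (hsub i k hk) (hmono i k hk) (hζΩ i) (sub_mem (hM' k) (hNk k))) 2).trans ?_
    rw [derivClass_sub (hΩ k).1 (hζΩ k) (hM' k) (hNk k), norm_sub_rev]
    exact hNa k
  · have h0 : L - ‖derivClass D μ N‖ ^ 2 = 0 := sub_eq_zero.2 hLN
    rw [← h0]
    exact haL.sub_const _

theorem tendstoLocallyUniformlyOn_kernelM_iUnion (hΩ : ∀ i, IsPlanarDomain (Ω i))
    (hw : ∀ i, AdmissibleWeight (Ω i) (w i)) (hμ : AdmissibleWeight D μ) (hD : D = ⋃ i, Ω i)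
    (hmono : ∀ i, ∃ j, ∀ k, j ≤ k → Ω i ⊆ Ω k ∧ ∀ z ∈ Ω i, w i z ≤ w k z ∧ w k z ≤ μ z)
    (hlim : ∀ᵐ z ∂(volume.restrict D), Tendsto (fun i => w i z) atTop (𝓝 (μ z)))
    (hn : 1 ≤ n) (hζ : ζ ∈ D) :
    TendstoLocallyUniformlyOn (fun i => kernelM (Ω i) (w i) n ζ) (kernelM D μ n ζ) atTop D := by
  choose j hj using hmono
  have hmem : ∀ {z}, z ∈ D → ∃ i, z ∈ Ω i := fun hz => by
    rw [hD] at hz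
    exact Set.mem_iUnion.1 hz
  have hΩD : ∀ i, Ω i ⊆ D := fun i => hD ▸ Set.subset_iUnion Ω i
  have hDd : IsPlanarDomain D := by
    refine ⟨hD ▸ isOpen_iUnion fun i => (hΩ i).1, ⟨ζ, hζ⟩,
      isPreconnected_of_forall ζ fun y hy => ?_⟩
    obtain ⟨i, hi⟩ := hmem hζ
    obtain ⟨k, hk⟩ := hmem hy
    exact ⟨Ω (max (j i) (j k)), hΩD _, (hj i _ (le_max_left _ _)).1 hi,
      (hj k _ (le_max_right _ _)).1 hk, (hΩ _).2.isPreconnected⟩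
  obtain ⟨i₀, hi₀⟩ := hmem hζ
  -- Early domains may miss `ζ`; from index `j i₀` on, all contain it, and dropping finitely many
  -- terms does not change the limit.
  set N := j i₀
  have hζΩ : ∀ i, ζ ∈ Ω (i + N) := fun i => (hj i₀ (i + N) (Nat.le_add_left _ _)).1 hi₀
  have key : TendstoLocallyUniformlyOn (fun i => kernelM (Ω (i + N)) (w (i + N)) n ζ)
      (kernelM D μ n ζ) atTop D := by
    refine tendstoLocallyUniformlyOn_kernel_of_exhaustion (Ω := fun i => Ω (i + N))
      (w := fun i => w (i + N)) (j := fun i => j (i + N)) hDd hμ (fun i => hΩ _) (fun i => hw _) hn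
      hζΩ (fun i => hΩD _) (fun z hz => ?_)
      (fun i k hk => (hj _ (k + N) (hk.trans (Nat.le_add_right _ _))).1)
      (fun i k hk z hz => ((hj _ (k + N) (hk.trans (Nat.le_add_right _ _))).2 z hz).1)
      -- The bound by `μ` is only assumed for late weights, so it is reached through the weight at
      -- the threshold index.
      (fun i z hz => ((hj _ _ le_rfl).2 z hz).1.trans ((hj _ _ le_rfl).2 z hz).2)
      (hlim.mono fun z hz => hz.comp (tendsto_add_atTop_nat N))
      (fun i => isKernelFunction_kernelM (hΩ _) (hζΩ i) (hw _) hn)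
      (isKernelFunction_kernelM hDd hζ hμ hn)
    obtain ⟨i, hi⟩ := hmem hz
    exact ⟨j i, (hj i _ (Nat.le_add_right _ _)).1 hi⟩
  intro u hu x hx
  obtain ⟨t, ht, h⟩ := key u hu x hx
  refine ⟨t, ht, ?_⟩
  rw [← map_add_atTop_eq_nat N, eventually_map]
  exact h

end Union

end ReducedBergman

/-! ### Density of first order kernels and intersections of domains -/

namespace ReducedBergman

variable {D : Set ℂ} {μ : ℂ → ℝ} {n : ℕ} {ζ : ℂ}

/-- At order one the base point only fixes an additive constant, so the space of derivatives is the
same for all base points. This lets kernels at different points be compared in one space. -/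
theorem sub_const_mem_adSubmodule_one (hD : IsOpen D) (hζ : ζ ∈ D) {t : ℂ} (ht : t ∈ D)
    {F : ℂ → ℂ} (hF : F ∈ adSubmodule hD hζ μ 1) :
    (fun z => F z - F t) ∈ adSubmodule hD ht μ 1 := by
  refine ⟨hF.1.sub_const _, fun k hk => ?_, ?_⟩
  · rw [Nat.lt_one_iff.1 hk, iteratedDeriv_zero, sub_self]
  · have : deriv (fun z => F z - F t) = deriv F := by ext z; exact deriv_sub_const _
    rw [this]
    exact hF.2.2

theorem derivClass_sub_const (F : ℂ → ℂ) (c : ℂ) :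
    derivClass D μ (fun z => F z - c) = derivClass D μ F := by
  have : deriv (fun z => F z - c) = deriv F := by ext z; exact deriv_sub_const _
  rw [derivClass, derivClass, this]

/-- The derivative of the first order kernel function at any point `t` reproduces derivatives. -/
theorem inner_kernel_one (hD : IsOpen D) (hζ : ζ ∈ D) (hμ : AdmissibleWeight D μ) {t : ℂ}
    (ht : t ∈ D) {M F : ℂ → ℂ} (hM : IsKernelFunction D μ 1 t M) (hF : F ∈ adSubmodule hD hζ μ 1) :
    inner ℂ (derivClass D μ M) (derivClass D μ F) = deriv F t := by
  have h := ((isKernelFunction_iff hD ht hμ).1 hM).2 _ (sub_const_mem_adSubmodule_one hD hζ ht hF)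
  rwa [derivClass_sub_const, iteratedDeriv_one, deriv_sub_const] at h

theorem kernel_one_mem_adLp (hD : IsOpen D) (hζ : ζ ∈ D) (hμ : AdmissibleWeight D μ) {t : ℂ}
    (ht : t ∈ D) {M : ℂ → ℂ} (hM : IsKernelFunction D μ 1 t M) :
    derivClass D μ M ∈ adLp hD hζ μ 1 := by
  rw [← derivClass_sub_const M (M ζ)]
  exact derivClass_mem_adLp hD hζ
    (sub_const_mem_adSubmodule_one hD ht hζ ((mem_adSubmodule_iff hD ht hμ).2 hM.1))

/-- The derivatives of the first order kernel functions span a dense subspace. -/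
theorem adLp_one_le_closure_span (hD : IsPlanarDomain D) (hζ : ζ ∈ D) (hμ : AdmissibleWeight D μ)
    {M : ℂ → ℂ → ℂ} (hM : ∀ t ∈ D, IsKernelFunction D μ 1 t (M t)) :
    adLp hD.1 hζ μ 1 ≤
      (Submodule.span ℂ ((fun t => derivClass D μ (M t)) '' D)).topologicalClosure := by
  set V := (Submodule.span ℂ ((fun t => derivClass D μ (M t)) '' D)).topologicalClosure with hV
  have : CompleteSpace V := (Submodule.isClosed_topologicalClosure _).completeSpace_coe
  have hle : V ≤ adLp hD.1 hζ μ 1 := by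
    refine Submodule.topologicalClosure_minimal _ (Submodule.span_le.2 ?_)
      (isClosed_adLp hD hζ hμ le_rfl)
    rintro _ ⟨t, ht, rfl⟩
    exact kernel_one_mem_adLp hD.1 hζ hμ ht (hM t ht)
  intro v hv
  have hPv : V.starProjection v ∈ V := Submodule.starProjection_apply_mem _ _
  -- The component of `v` orthogonal to all kernels is again some `F'`, and orthogonality to the
  -- kernel at `t` says `F' t = 0`.
  obtain ⟨F, hF⟩ := sub_mem hv (hle hPv)
  have hF' : derivClass D μ (F : ℂ → ℂ) = v - V.starProjection v := hF
  have h0 : derivClass D μ (F : ℂ → ℂ) = 0 := by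
    have hz : deriv (F : ℂ → ℂ) =ᵐ[weightedArea D μ] 0 :=
      ae_weightedArea_of_forall hD.1 fun t ht => by
      have hk : derivClass D μ (M t) ∈ V :=
        Submodule.le_topologicalClosure _ (Submodule.subset_span ⟨t, ht, rfl⟩)
      rw [← inner_kernel_one hD.1 hζ hμ ht (hM t ht) F.2, hF']
      exact (Submodule.mem_orthogonal V _).1 (Submodule.sub_starProjection_mem_orthogonal v) _ hk
    rw [derivClass, l2class_congr hz]
    have h1 := l2class_smul (D := D) (μ := μ) (f := 0) 0 MemLp.zero
    rwa [zero_smul, zero_smul] at h1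
  rw [sub_eq_zero.1 (hF'.symm.trans h0)]
  exact hPv

section Inter

variable {Ω : ℕ → Set ℂ} {w : ℕ → ℂ → ℝ}

/-- A vector of `L²_μ(D)` is approximable if it is approximated by derivatives of elements of
`AD^{w i}(Ω i, ζⁿ)` whose norms do not essentially exceed its own norm. -/
def Approximable (Ω : ℕ → Set ℂ) (w : ℕ → ℂ → ℝ) (D : Set ℂ) (μ : ℂ → ℝ) (n : ℕ) (ζ : ℂ)
    (v : Lp ℂ 2 (weightedArea D μ)) : Prop :=
  ∀ ε > 0, ∀ᶠ i in atTop, ∃ F ∈ adSpace (Ω i) (w i) n ζ,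
    ‖derivClass D μ F - v‖ < ε ∧ ‖derivClass (Ω i) (w i) F‖ < ‖v‖ + ε

theorem Approximable.of_mem_closure {s : Set (Lp ℂ 2 (weightedArea D μ))}
    (h : ∀ v ∈ s, Approximable Ω w D μ n ζ v) {v : Lp ℂ 2 (weightedArea D μ)}
    (hv : v ∈ closure s) : Approximable Ω w D μ n ζ v := by
  intro ε hε
  obtain ⟨u, hu, hd⟩ := Metric.mem_closure_iff.1 hv (ε / 2) (half_pos hε)
  rw [dist_comm, dist_eq_norm] at hd
  filter_upwards [h u hu (ε / 2) (half_pos hε)] with i hi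
  obtain ⟨F, hF, h1, h2⟩ := hi
  refine ⟨F, hF, ?_, ?_⟩
  · linarith [norm_sub_le_norm_sub_add_norm_sub (derivClass D μ F) u v]
  · linarith [norm_sub_norm_le u v]

/-- Convergence of the norms of the kernel functions implies their convergence. -/
theorem tendsto_norm_kernel_sub_kernel
    (hD : IsPlanarDomain D) (hμ : AdmissibleWeight D μ)
    (hΩ : ∀ i, IsPlanarDomain (Ω i)) (hw : ∀ i, AdmissibleWeight (Ω i) (w i))
    (hDΩ : ∀ i, D ⊆ Ω i) (hle : ∀ i, ∀ z ∈ D, μ z ≤ w i z)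
    (hζ : ζ ∈ D) {M : ℕ → ℂ → ℂ} {N : ℂ → ℂ}
    (hM : ∀ i, IsKernelFunction (Ω i) (w i) n ζ (M i)) (hN : IsKernelFunction D μ n ζ N)
    (h : Tendsto (fun i => ‖derivClass (Ω i) (w i) (M i)‖ ^ 2) atTop
      (𝓝 (‖derivClass D μ N‖ ^ 2))) :
    Tendsto (fun i => ‖derivClass D μ (M i) - derivClass D μ N‖) atTop (𝓝 0) := by
  refine tendsto_norm_zero_of_sq_le (Eventually.of_forall fun i =>
    norm_sq_kernel_sub_kernel_le hD.1 (hΩ i).1 hμ (hw i) (hDΩ i) (hle i) hζ hN (hM i)) ?_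
  rw [← sub_self (‖derivClass D μ N‖ ^ 2)]
  exact h.const_sub _

theorem tendstoLocallyUniformlyOn_kernel_of_tendsto_norm
    (hD : IsPlanarDomain D) (hμ : AdmissibleWeight D μ)
    (hΩ : ∀ i, IsPlanarDomain (Ω i)) (hw : ∀ i, AdmissibleWeight (Ω i) (w i))
    (hDΩ : ∀ i, D ⊆ Ω i) (hle : ∀ i, ∀ z ∈ D, μ z ≤ w i z)
    (hn : 1 ≤ n) (hζ : ζ ∈ D)
    {M : ℕ → ℂ → ℂ} {N : ℂ → ℂ}
    (hM : ∀ i, IsKernelFunction (Ω i) (w i) n ζ (M i)) (hN : IsKernelFunction D μ n ζ N)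
    (h : Tendsto (fun i => ‖derivClass (Ω i) (w i) (M i)‖ ^ 2) atTop
      (𝓝 (‖derivClass D μ N‖ ^ 2))) :
    TendstoLocallyUniformlyOn M N atTop D :=
  tendstoLocallyUniformlyOn_of_tendsto_derivClass hD hζ hμ hn
    (Eventually.of_forall fun i => mem_adSubmodule_of_subset hD.1 (hΩ i).1 (hDΩ i) (hle i) hζ
      ((mem_adSubmodule_iff (hΩ i).1 (hDΩ i hζ) (hw i)).2 (hM i).1))
    ((mem_adSubmodule_iff hD.1 hζ hμ).2 hN.1)
    (tendsto_norm_kernel_sub_kernel hD hμ hΩ hw hDΩ hle hζ hM hN h)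

/-- If the adjoint restrictions of `v` converge to `v`, then `v` is approximable. -/
theorem approximable_of_tendsto
    (hD : IsPlanarDomain D)
    (hΩ : ∀ i, IsPlanarDomain (Ω i)) (hw : ∀ i, AdmissibleWeight (Ω i) (w i))
    (hDΩ : ∀ i, D ⊆ Ω i) (hle : ∀ i, ∀ z ∈ D, μ z ≤ w i z)
    (hζ : ζ ∈ D) {v : Lp ℂ 2 (weightedArea D μ)} {F : ℕ → ℂ → ℂ}
    (hF : ∀ i, F i ∈ adSubmodule (hΩ i).1 (hDΩ i hζ) (w i) n)
    (hinner : ∀ i, inner ℂ (derivClass (Ω i) (w i) (F i)) (derivClass (Ω i) (w i) (F i)) =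
      inner ℂ v (derivClass D μ (F i)))
    (hlim : Tendsto (fun i => derivClass D μ (F i)) atTop (𝓝 v)) :
    Approximable Ω w D μ n ζ v := by
  intro ε hε
  filter_upwards [Metric.tendsto_nhds.1 hlim ε hε] with i hi
  refine ⟨F i, (mem_adSubmodule_iff (hΩ i).1 (hDΩ i hζ) (hw i)).1 (hF i),
    by rwa [← dist_eq_norm], ?_⟩
  have h1 := norm_derivClass_le_of_subset hD.1 (hΩ i).1 (hDΩ i) (hle i) hζ (hF i)
  -- Dividing by the norm on `Ω i` gives at most `‖v‖`, so the adjoint of restriction does not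
  -- increase norms.
  have h2 : ‖derivClass (Ω i) (w i) (F i)‖ ^ 2 ≤ ‖v‖ * ‖derivClass (Ω i) (w i) (F i)‖ := by
    have h3 := congrArg norm (hinner i)
    rw [inner_self_eq_norm_sq_to_K, norm_pow, RCLike.norm_ofReal, abs_norm] at h3
    rw [h3]
    exact (norm_inner_le_norm _ _).trans (mul_le_mul_of_nonneg_left h1 (norm_nonneg _))
  rcases (norm_nonneg (derivClass (Ω i) (w i) (F i))).eq_or_lt with h | h
  · rw [← h]
    positivity
  · rw [sq] at h2
    linarith [le_of_mul_le_mul_right h2 h]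

/-- Approximability is evidently closed but not evidently linear. Linearity is obtained from the
adjoints of restriction, on the span of the kernels, and density does the rest. -/
theorem approximable_of_mem_adLp_one
    (hD : IsPlanarDomain D) (hμ : AdmissibleWeight D μ)
    (hΩ : ∀ i, IsPlanarDomain (Ω i)) (hw : ∀ i, AdmissibleWeight (Ω i) (w i))
    (hDΩ : ∀ i, D ⊆ Ω i) (hle : ∀ i, ∀ z ∈ D, μ z ≤ w i z)
    (hζ : ζ ∈ D) {M : ℕ → ℂ → ℂ → ℂ} {N : ℂ → ℂ → ℂ}
    (hM : ∀ i, ∀ t ∈ D, IsKernelFunction (Ω i) (w i) 1 t (M i t))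
    (hN : ∀ t ∈ D, IsKernelFunction D μ 1 t (N t))
    (h : ∀ t ∈ D, Tendsto (fun i => ‖derivClass (Ω i) (w i) (M i t)‖ ^ 2) atTop
      (𝓝 (‖derivClass D μ (N t)‖ ^ 2)))
    {v : Lp ℂ 2 (weightedArea D μ)} (hv : v ∈ adLp hD.1 hζ μ 1) :
    Approximable Ω w D μ 1 ζ v := by
  have hres : ∀ i, ∀ F ∈ adSubmodule (hΩ i).1 (hDΩ i hζ) (w i) 1, F ∈ adSubmodule hD.1 hζ μ 1 :=
    fun i F hF => mem_adSubmodule_of_subset hD.1 (hΩ i).1 (hDΩ i) (hle i) hζ hF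
  -- `F i` represents the adjoint of restriction applied to `v`, so `Q` consists of the `v`
  -- recovered in the limit from their adjoint images.
  let Q : Submodule ℂ (Lp ℂ 2 (weightedArea D μ)) :=
    { carrier := {v | ∃ F : ℕ → ℂ → ℂ,
        (∀ i, F i ∈ adSubmodule (hΩ i).1 (hDΩ i hζ) (w i) 1) ∧
        (∀ i, ∀ g ∈ adSubmodule (hΩ i).1 (hDΩ i hζ) (w i) 1,
          inner ℂ (derivClass (Ω i) (w i) (F i)) (derivClass (Ω i) (w i) g) =
            inner ℂ v (derivClass D μ g)) ∧
        Tendsto (fun i => derivClass D μ (F i)) atTop (𝓝 v)}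
      add_mem' := by
        rintro u v ⟨F, hF, hFi, hFl⟩ ⟨G, hG, hGi, hGl⟩
        refine ⟨fun i => F i + G i, fun i => add_mem (hF i) (hG i), fun i g hg => ?_,
          (hFl.add hGl).congr fun i => (derivClass_add hD.1 hζ (hres i _ (hF i))
            (hres i _ (hG i))).symm⟩
        rw [derivClass_add (hΩ i).1 (hDΩ i hζ) (hF i) (hG i), inner_add_left, inner_add_left,
          hFi i g hg, hGi i g hg]
      zero_mem' := by
        refine ⟨fun _ => 0, fun i => zero_mem _, fun i g _ => ?_, ?_⟩
        · have h0 : derivClass (Ω i) (w i) 0 = 0 :=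
            map_zero (adToLp (hΩ i).1 (hDΩ i hζ) (w i) 1)
          rw [h0, inner_zero_left, inner_zero_left]
        · have h0 : derivClass D μ 0 = 0 := map_zero (adToLp hD.1 hζ μ 1)
          simp only [h0, tendsto_const_nhds]
      smul_mem' := by
        rintro c v ⟨F, hF, hFi, hFl⟩
        refine ⟨fun i => c • F i, fun i => Submodule.smul_mem _ c (hF i), fun i g hg => ?_,
          (hFl.const_smul c).congr fun i => (derivClass_smul hD.1 hζ c (hres i _ (hF i))).symm⟩
        rw [derivClass_smul (hΩ i).1 (hDΩ i hζ) c (hF i), inner_smul_left, inner_smul_left,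
          hFi i g hg] }
  have hspan : Submodule.span ℂ ((fun t => derivClass D μ (N t)) '' D) ≤ Q := by
    refine Submodule.span_le.2 ?_
    rintro _ ⟨t, ht, rfl⟩
    -- The adjoint sends the kernel of `D` at `t` to that of `Ω i` at `t`, shifted by a constant to
    -- vanish at `ζ`.
    refine ⟨fun i z => M i t z - M i t ζ, fun i => ?_, fun i g hg => ?_, ?_⟩
    · exact sub_const_mem_adSubmodule_one (hΩ i).1 (hDΩ i ht) (hDΩ i hζ)
        ((mem_adSubmodule_iff (hΩ i).1 (hDΩ i ht) (hw i)).2 (hM i t ht).1)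
    · rw [derivClass_sub_const, inner_kernel_one (hΩ i).1 (hDΩ i hζ) (hw i) (hDΩ i ht)
        (hM i t ht) hg,
        inner_kernel_one hD.1 hζ hμ ht (hN t ht) (hres i g hg)]
    · simp only [derivClass_sub_const]
      exact tendsto_iff_norm_sub_tendsto_zero.2 (tendsto_norm_kernel_sub_kernel hD hμ hΩ hw hDΩ hle
        ht (fun i => hM i t ht) (hN t ht) (h t ht))
  have hv' : v ∈ closure (Submodule.span ℂ ((fun t => derivClass D μ (N t)) '' D) : Set _) := by
    rw [← Submodule.topologicalClosure_coe]
    exact adLp_one_le_closure_span hD hζ hμ hN hv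
  refine Approximable.of_mem_closure (fun u hu => ?_) hv'
  obtain ⟨F, hF, hFi, hFl⟩ := hspan hu
  exact approximable_of_tendsto hD hΩ hw hDΩ hle hζ hF (fun i => hFi i _ (hF i)) hFl

/-- Approximability passes to functions vanishing to one order more. -/
theorem approximable_succ
    (hD : IsPlanarDomain D) (hμ : AdmissibleWeight D μ)
    (hΩ : ∀ i, IsPlanarDomain (Ω i)) (hw : ∀ i, AdmissibleWeight (Ω i) (w i))
    (hDΩ : ∀ i, D ⊆ Ω i) (hle : ∀ i, ∀ z ∈ D, μ z ≤ w i z)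
    (hn : 1 ≤ n) (hζ : ζ ∈ D)
    (h : ∀ v ∈ adLp hD.1 hζ μ n, Approximable Ω w D μ n ζ v) :
    ∀ v ∈ adLp hD.1 hζ μ (n + 1), Approximable Ω w D μ (n + 1) ζ v := by
  have hres : ∀ i, ∀ F ∈ adSubmodule (hΩ i).1 (hDΩ i hζ) (w i) n, F ∈ adSubmodule hD.1 hζ μ n :=
    fun i F hF => mem_adSubmodule_of_subset hD.1 (hΩ i).1 (hDΩ i) (hle i) hζ hF
  have hsucc : ∀ i, ∀ F ∈ adSubmodule (hΩ i).1 (hDΩ i hζ) (w i) n, iteratedDeriv n F ζ = 0 →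
      F ∈ adSpace (Ω i) (w i) (n + 1) ζ := by
    intro i F hF h0
    refine (mem_adSubmodule_iff (hΩ i).1 (hDΩ i hζ) (hw i)).1 ⟨hF.1, fun k hk => ?_, hF.2.2⟩
    rcases (Nat.lt_succ_iff.1 hk).lt_or_eq with hk | rfl
    · exact hF.2.1 k hk
    · exact h0
  rintro _ ⟨f, rfl⟩
  have hfn : (f : ℂ → ℂ) ∈ adSubmodule hD.1 hζ μ n :=
    ⟨f.2.1, fun k hk => f.2.2.1 k (hk.trans n.lt_succ_self), f.2.2.2⟩
  have hf0 : iteratedDeriv n (f : ℂ → ℂ) ζ = 0 := f.2.2.1 n n.lt_succ_self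
  change Approximable Ω w D μ (n + 1) ζ (derivClass D μ (f : ℂ → ℂ))
  generalize (f : ℂ → ℂ) = f at hfn hf0
  have hfA := h _ (derivClass_mem_adLp hD.1 hζ hfn)
  -- If the `n`-th derivative at `ζ` vanishes on the whole space, the approximants already vanish to
  -- the next order.
  by_cases hall : ∀ F ∈ adSubmodule hD.1 hζ μ n, iteratedDeriv n F ζ = 0
  · intro ε hε
    filter_upwards [hfA ε hε] with i hi
    obtain ⟨F, hF, h1⟩ := hi
    have hF' := (mem_adSubmodule_iff (hΩ i).1 (hDΩ i hζ) (hw i)).2 hF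
    exact ⟨F, hsucc i F hF' (hall F (hres i F hF')), h1⟩
  push Not at hall
  obtain ⟨y, hy, hy0⟩ := hall
  obtain ⟨C, hC0, hC⟩ := exists_norm_iteratedDeriv_le (n := n) hD.1 hζ hμ (n - 1)
  rw [Nat.sub_add_cancel hn] at hC
  have hCsub : ∀ F ∈ adSubmodule hD.1 hζ μ n, ∀ G ∈ adSubmodule hD.1 hζ μ n,
      ‖iteratedDeriv n F ζ - iteratedDeriv n G ζ‖ ≤
        C * ‖derivClass D μ F - derivClass D μ G‖ := by
    intro F hF G hG
    have h1 := hC _ (sub_mem hF hG)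
    have h2 := iteratedDeriv_sub_smul hD.1 hζ 1 n hF hG
    rw [one_smul, one_mul] at h2
    rwa [h2, derivClass_sub hD.1 hζ hF hG] at h1
  set a := ‖iteratedDeriv n y ζ‖ with ha
  have ha0 : 0 < a := norm_pos_iff.2 hy0
  set B := ‖derivClass D μ y‖ + 1 with hB
  have hB0 : 0 < B := by positivity
  intro ε hε
  -- The correction `c • Y` will have norm at most `(2Cδ/a) B`, so `δ` is chosen to make the total
  -- error exactly `ε`.
  set δ := ε / (1 + 2 * C * B / a) with hδ
  have hδ0 : 0 < δ := by positivity
  have hδε : δ + 2 * C * δ / a * B = ε := by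
    rw [hδ]
    field_simp
  -- The bound `1` keeps the norm of `Y` below `B`; the other keeps its `n`-th derivative at `ζ` at
  -- least `a / 2` in modulus.
  have hη : 0 < min 1 (a / (2 * (C + 1))) := lt_min one_pos (by positivity)
  filter_upwards [hfA δ hδ0, h _ (derivClass_mem_adLp hD.1 hζ hy) _ hη] with i hX hY
  obtain ⟨X, hX, hX1, hX2⟩ := hX
  obtain ⟨Y, hY, hY1, hY2⟩ := hY
  replace hX := (mem_adSubmodule_iff (hΩ i).1 (hDΩ i hζ) (hw i)).2 hX
  replace hY := (mem_adSubmodule_iff (hΩ i).1 (hDΩ i hζ) (hw i)).2 hY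
  have hYB : ‖derivClass (Ω i) (w i) Y‖ ≤ B := by
    linarith [min_le_left 1 (a / (2 * (C + 1)))]
  have hYB' : ‖derivClass D μ Y‖ ≤ B :=
    (norm_derivClass_le_of_subset hD.1 (hΩ i).1 (hDΩ i) (hle i) hζ hY).trans hYB
  have hYa : a / 2 ≤ ‖iteratedDeriv n Y ζ‖ := by
    have h1 := hCsub Y (hres i Y hY) y hy
    have h2 : C * ‖derivClass D μ Y - derivClass D μ y‖ ≤ a / 2 := by
      have h3 := (hY1.trans_le (min_le_right _ _)).le
      calc C * ‖derivClass D μ Y - derivClass D μ y‖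
          ≤ (C + 1) * (a / (2 * (C + 1))) := by gcongr; linarith
        _ = a / 2 := by field_simp
    have h4 := norm_sub_norm_le (iteratedDeriv n y ζ) (iteratedDeriv n Y ζ)
    rw [norm_sub_rev] at h4
    linarith
  have hY0 : iteratedDeriv n Y ζ ≠ 0 := norm_pos_iff.1 (by linarith)
  have hXa : ‖iteratedDeriv n X ζ‖ ≤ C * δ := by
    have h1 := hCsub X (hres i X hX) f hfn
    rw [hf0, sub_zero] at h1
    exact h1.trans (mul_le_mul_of_nonneg_left hX1.le hC0)
  -- This multiple cancels the `n`-th derivative of `X`, which is small because that of `f` is zero.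
  set c := iteratedDeriv n X ζ / iteratedDeriv n Y ζ with hc
  have hcn : ‖c‖ ≤ 2 * C * δ / a := by
    rw [hc, norm_div, div_le_div_iff₀ (by linarith) ha0]
    nlinarith [norm_nonneg (iteratedDeriv n X ζ), mul_nonneg hC0 hδ0.le]
  have hcB : ‖c‖ * B ≤ 2 * C * δ / a * B := mul_le_mul_of_nonneg_right hcn hB0.le
  have hcY := Submodule.smul_mem _ c hY
  refine ⟨X - c • Y, hsucc i _ (sub_mem hX hcY) ?_, ?_, ?_⟩
  · rw [iteratedDeriv_sub_smul (hΩ i).1 (hDΩ i hζ) c n hX hY, hc, div_mul_cancel₀ _ hY0, sub_self]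
  · rw [derivClass_sub hD.1 hζ (hres i _ hX) (hres i _ hcY),
      derivClass_smul hD.1 hζ c (hres i _ hY), sub_right_comm]
    have h1 := norm_sub_le (derivClass D μ X - derivClass D μ f) (c • derivClass D μ Y)
    rw [norm_smul] at h1
    have h2 := mul_le_mul_of_nonneg_left hYB' (norm_nonneg c)
    linarith
  · rw [derivClass_sub (hΩ i).1 (hDΩ i hζ) hX hcY, derivClass_smul (hΩ i).1 (hDΩ i hζ) c hY]
    have h1 := norm_sub_le (derivClass (Ω i) (w i) X) (c • derivClass (Ω i) (w i) Y)
    rw [norm_smul] at h1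
    have h2 := mul_le_mul_of_nonneg_left hYB (norm_nonneg c)
    linarith

/-- If the kernel function of `D` is approximable, the norms of the kernel functions converge. -/
theorem tendsto_norm_sq_kernel_of_approximable
    (hD : IsPlanarDomain D) (hμ : AdmissibleWeight D μ)
    (hΩ : ∀ i, IsPlanarDomain (Ω i)) (hw : ∀ i, AdmissibleWeight (Ω i) (w i))
    (hDΩ : ∀ i, D ⊆ Ω i) (hle : ∀ i, ∀ z ∈ D, μ z ≤ w i z)
    (hζ : ζ ∈ D) {M : ℕ → ℂ → ℂ} {N : ℂ → ℂ}
    (hM : ∀ i, IsKernelFunction (Ω i) (w i) n ζ (M i)) (hN : IsKernelFunction D μ n ζ N)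
    (h : Approximable Ω w D μ n ζ (derivClass D μ N)) :
    Tendsto (fun i => ‖derivClass (Ω i) (w i) (M i)‖ ^ 2) atTop
      (𝓝 (‖derivClass D μ N‖ ^ 2)) := by
  refine Tendsto.pow ?_ 2
  have hle' : ∀ i, ‖derivClass (Ω i) (w i) (M i)‖ ≤ ‖derivClass D μ N‖ := fun i =>
    (sq_le_sq₀ (norm_nonneg _) (norm_nonneg _)).1 (norm_sq_kernel_le_of_subset hD.1 (hΩ i).1 hμ (hw i) (hDΩ i) (hle i) hζ hN
      (hM i))
  set m := ‖derivClass D μ N‖ with hm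
  refine tendsto_order.2 ⟨fun b hb => ?_, fun b hb => Eventually.of_forall fun i =>
    (hle' i).trans_lt hb⟩
  have hm0 : 0 ≤ m := norm_nonneg _
  -- With `η = (m - b)/3`, the estimates give `m² ≤ x(m + η) + mη ≤ m(x + 2η)`; for `m > 0` and `x ≤
  -- b` this contradicts `b + 2η < m`.
  filter_upwards [h ((m - b) / 3) (by linarith)] with i hi
  obtain ⟨F, hF, h1, h2⟩ := hi
  have hF' := (mem_adSubmodule_iff (hΩ i).1 (hDΩ i hζ) (hw i)).2 hF
  have hFD := mem_adSubmodule_of_subset hD.1 (hΩ i).1 (hDΩ i) (hle i) hζ hF'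
  have h3 := norm_iteratedDeriv_le_norm_kernel (hΩ i).1 (hDΩ i hζ) (hw i) hF' (hM i)
  have h4 : ‖iteratedDeriv n N ζ‖ = m ^ 2 := by
    rw [← norm_sq_derivClass_kernel hD.1 hζ hμ hN, Complex.norm_real, Real.norm_of_nonneg
      (sq_nonneg _)]
  have hN' := (mem_adSubmodule_iff hD.1 hζ hμ).2 hN.1
  have h5 := norm_iteratedDeriv_le_norm_kernel hD.1 hζ hμ (sub_mem hN' hFD) hN
  have h6 := iteratedDeriv_sub_smul hD.1 hζ 1 n hN' hFD
  rw [one_smul, one_mul] at h6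
  rw [h6, derivClass_sub hD.1 hζ hN' hFD, norm_sub_rev (derivClass D μ N), ← hm] at h5
  have h7 := norm_sub_norm_le (iteratedDeriv n N ζ) (iteratedDeriv n F ζ)
  rw [h4] at h7
  set x := ‖derivClass (Ω i) (w i) (M i)‖
  have hx0 : 0 ≤ x := norm_nonneg _
  by_contra hxb
  push Not at hxb
  have h8 : x * ‖derivClass (Ω i) (w i) F‖ ≤ x * m + m * ((m - b) / 3) :=
    calc x * ‖derivClass (Ω i) (w i) F‖ ≤ x * (m + (m - b) / 3) :=
          mul_le_mul_of_nonneg_left h2.le hx0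
      _ ≤ x * m + m * ((m - b) / 3) := by
          rw [mul_add]
          exact add_le_add_right (mul_le_mul_of_nonneg_right (hle' i) (by linarith)) _
  have h9 := mul_le_mul_of_nonneg_left h1.le hm0
  rcases hm0.eq_or_lt with h0 | h0
  · linarith
  · have h10 : m * m ≤ m * (x + 2 * ((m - b) / 3)) := by linarith
    linarith [le_of_mul_le_mul_left h10 h0]

end Inter

end ReducedBergman

/-! ### Convergence for intersections at every order, and the theorem -/

namespace ReducedBergman

variable {D : Set ℂ} {μ : ℂ → ℝ} {n : ℕ} {ζ : ℂ}

/-- Turns convergence of the kernels on the diagonal into convergence of norms. -/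
theorem reducedKernel_one_self (hD : IsPlanarDomain D) (hμ : AdmissibleWeight D μ) (hζ : ζ ∈ D) :
    reducedKernel D μ 1 ζ ζ = ((‖derivClass D μ (kernelM D μ 1 ζ)‖ ^ 2 : ℝ) : ℂ) := by
  rw [norm_sq_derivClass_kernel hD.1 hζ hμ (isKernelFunction_kernelM hD hζ hμ le_rfl),
    iteratedDeriv_one, reducedKernel]

theorem tendstoLocallyUniformlyOn_kernelM_iInter {Ω : ℕ → Set ℂ} {w : ℕ → ℂ → ℝ}
    (hD : IsPlanarDomain D) (hμ : AdmissibleWeight D μ) (hΩ : ∀ i, IsPlanarDomain (Ω i))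
    (hw : ∀ i, AdmissibleWeight (Ω i) (w i)) (hDΩ : ∀ i, D ⊆ Ω i)
    (hle : ∀ i, ∀ z ∈ D, μ z ≤ w i z)
    (hK : ∀ t ∈ D, Tendsto (fun i => reducedKernel (Ω i) (w i) 1 t t) atTop
      (𝓝 (reducedKernel D μ 1 t t)))
    (hn : 1 ≤ n) (hζ : ζ ∈ D) :
    TendstoLocallyUniformlyOn (fun i => kernelM (Ω i) (w i) n ζ) (kernelM D μ n ζ) atTop D := by
  have hM : ∀ m, 1 ≤ m → ∀ i, ∀ t ∈ D,
      IsKernelFunction (Ω i) (w i) m t (kernelM (Ω i) (w i) m t) := fun m hm i t ht =>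
    isKernelFunction_kernelM (hΩ i) (hDΩ i ht) (hw i) hm
  have hN : ∀ m, 1 ≤ m → ∀ t ∈ D, IsKernelFunction D μ m t (kernelM D μ m t) := fun m hm t ht =>
    isKernelFunction_kernelM hD ht hμ hm
  have hnorm : ∀ t ∈ D, Tendsto (fun i => ‖derivClass (Ω i) (w i) (kernelM (Ω i) (w i) 1 t)‖ ^ 2)
      atTop (𝓝 (‖derivClass D μ (kernelM D μ 1 t)‖ ^ 2)) := fun t ht => by
    have h := (Complex.continuous_re.tendsto _).comp (hK t ht)
    rw [reducedKernel_one_self hD hμ ht, Complex.ofReal_re] at h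
    refine h.congr fun i => ?_
    rw [Function.comp_apply, reducedKernel_one_self (hΩ i) (hw i) (hDΩ i ht), Complex.ofReal_re]
  have happ : ∀ v ∈ adLp hD.1 hζ μ n, Approximable Ω w D μ n ζ v := by
    induction n, hn using Nat.le_induction with
    | base =>
      exact fun v hv => approximable_of_mem_adLp_one hD hμ hΩ hw hDΩ hle hζ (hM 1 le_rfl)
        (hN 1 le_rfl) hnorm hv
    | succ m hm ih => exact approximable_succ hD hμ hΩ hw hDΩ hle hm hζ ih
  exact tendstoLocallyUniformlyOn_kernel_of_tendsto_norm hD hμ hΩ hw hDΩ hle hn hζ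
    (fun i => hM n hn i ζ hζ) (hN n hn ζ hζ)
    (tendsto_norm_sq_kernel_of_approximable hD hμ hΩ hw hDΩ hle hζ (fun i => hM n hn i ζ hζ)
      (hN n hn ζ hζ) (happ _ (derivClass_mem_adLp hD.1 hζ
        ((mem_adSubmodule_iff hD.1 hζ hμ).2 (hN n hn ζ hζ).1))))

end ReducedBergman

theorem mainTheorem6 (Ω : ℕ → Set ℂ) (w : ℕ → ℂ → ℝ) (D : Set ℂ) (μ : ℂ → ℝ)
    (hΩ : ∀ i, ReducedBergman.IsPlanarDomain (Ω i))
    (hw : ∀ i, ReducedBergman.AdmissibleWeight (Ω i) (w i))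
    (hμ : ReducedBergman.AdmissibleWeight D μ) :
    -- the kernel functions are well defined
    (∀ (G : Set ℂ) (ν : ℂ → ℝ), ReducedBergman.IsPlanarDomain G →
      ReducedBergman.AdmissibleWeight G ν → ∀ n : ℕ, 1 ≤ n → ∀ ζ ∈ G,
        ReducedBergman.IsKernelFunction G ν n ζ (ReducedBergman.kernelM G ν n ζ) ∧
        ∀ M, ReducedBergman.IsKernelFunction G ν n ζ M →
          Set.EqOn M (ReducedBergman.kernelM G ν n ζ) G) ∧
    -- unions
    (D = ⋃ i, Ω i →
      (∀ i, ∃ j, ∀ k, j ≤ k → Ω i ⊆ Ω k ∧ ∀ z ∈ Ω i, w i z ≤ w k z ∧ w k z ≤ μ z) →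
      (∀ᵐ z ∂(volume.restrict D), Tendsto (fun i => w i z) atTop (𝓝 (μ z))) →
      ∀ n : ℕ, 1 ≤ n → ∀ ξ ∈ D,
        TendstoLocallyUniformlyOn (fun i => ReducedBergman.kernelM (Ω i) (w i) n ξ)
          (ReducedBergman.kernelM D μ n ξ) atTop D) ∧
    -- intersections
    (D = ⋂ i, Ω i → ReducedBergman.IsPlanarDomain D →
      (∀ i, ∀ z ∈ D, μ z ≤ w i z) →
      (∀ᵐ z ∂(volume.restrict D), Tendsto (fun i => w i z) atTop (𝓝 (μ z))) →
      (∀ t ∈ D, Tendsto (fun i => ReducedBergman.reducedKernel (Ω i) (w i) 1 t t) atTop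
        (𝓝 (ReducedBergman.reducedKernel D μ 1 t t))) →
      (∀ ξ ∈ D,
        TendstoLocallyUniformlyOn (fun i => ReducedBergman.kernelM (Ω i) (w i) 1 ξ)
          (ReducedBergman.kernelM D μ 1 ξ) atTop D) ∧
      (∀ n : ℕ, 1 < n → ∀ ξ ∈ D \ ReducedBergman.kernelZeros D μ,
        TendstoLocallyUniformlyOn (fun i => ReducedBergman.kernelM (Ω i) (w i) n ξ)
          (ReducedBergman.kernelM D μ n ξ) atTop D)) := by
  refine ⟨fun G ν hG hν n hn ζ hζ => ⟨ReducedBergman.isKernelFunction_kernelM hG hζ hν hn, fun M hM =>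
    hM.eqOn hG hζ hν hn (ReducedBergman.isKernelFunction_kernelM hG hζ hν hn)⟩,
    fun hD hmono hlim n hn ξ hξ =>
      ReducedBergman.tendstoLocallyUniformlyOn_kernelM_iUnion hΩ hw hμ hD hmono hlim hn hξ,
    fun hD hDd hle _ hK => ?_⟩
  have hDΩ : ∀ i, D ⊆ Ω i := fun i => hD ▸ Set.iInter_subset Ω i
  exact ⟨fun ξ hξ => ReducedBergman.tendstoLocallyUniformlyOn_kernelM_iInter hDd hμ hΩ hw hDΩ hle hK
    le_rfl hξ, fun n hn ξ hξ => ReducedBergman.tendstoLocallyUniformlyOn_kernelM_iInter hDd hμ hΩ hw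
    hDΩ hle hK hn.le hξ.1⟩
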